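/- Let $m,n,a,b$ be integers with $0\le a\le m$ and $0\le b\le n$. An $(m,n,a,b)$-tensor code over a field $\mathbb F$ is a code $C=C_{\mathrm{col}}\otimes C_{\mathrm{row}}$, i.e. the space of all $m\times n$ matrices over $\mathbb F$ whose columns lie in $C_{\mathrm{col}}$ and whose rows lie in $C_{\mathrm{row}}$, where $C_{\mathrm{col}}\subseteq\mathbb F^m$ is a subspace of dimension $m-a$ and $C_{\mathrm{row}}\subseteq\mathbb F^n$ is a subspace of dimension $n-b$. An erasure pattern $E\subseteq[m]\times[n]$ is correctable by $C$ if every codeword of $C$ is determined by its entries outside $E$. An $(m,n,a,b)$-tensor code is maximally recoverable (MR) if it corrects every erasure pattern that is correctable by some $(m,n,a,b)$-tensor code over some field. There are a deterministic algorithm and a constant $K$ such that, for all $m\ge 1$, $0\le b\le n$ and $E\subseteq[m]\times[n]$, the algorithm, given $m,n,b$ and the $0/1$ matrix of $E$, halts after at most $$K\cdot\min\left(\binom m1,\binom nb\right)\cdot(m+n)^3\ \le\ K\,m\,(m+n)^3$$ steps and outputs $1$ or $0$, the output being $1$ if and only if $E$ is correctable by some $(m,n,1,b)$-tensor code over some field;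 moreover, for every $(m,n,1,b)$-MR tensor code $C$ (over any field), the output is $1$ if and only if $E$ is correctable by $C$. Time is counted on a random access machine with words of $O(\log(m+n+2))$ bits, on which addition, subtraction and multiplication of words, indirect memory access and the test of a word against $0$ take one step each. -/

import Mathlib

/-! ### Tensor codes and maximal recoverability -/

/-- The tensor product of a column code and a row code: the `m × n` matrices all of whose rows lie
in the row code and all of whose columns lie in the column code. -/
def tensorCode {F : Type*} [Field F] {m n : ℕ} (Ccol : Submodule F (Fin m → F))
    (Crow : Submodule F (Fin n → F)) : Submodule F (Matrix (Fin m) (Fin n) F) where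
  carrier := {X | (∀ i, (fun j => X i j) ∈ Crow) ∧ ∀ j, (fun i => X i j) ∈ Ccol}
  add_mem' hX hY := ⟨fun i => Crow.add_mem (hX.1 i) (hY.1 i),
    fun j => Ccol.add_mem (hX.2 j) (hY.2 j)⟩
  zero_mem' := ⟨fun _ => Crow.zero_mem, fun _ => Ccol.zero_mem⟩
  smul_mem' c _ hX := ⟨fun i => Crow.smul_mem c (hX.1 i), fun j => Ccol.smul_mem c (hX.2 j)⟩

/-- `C` is an `(m, n, a, b)`-tensor code: the tensor product of an `(m, m - a)`-code (the column
code) and an `(n, n - b)`-code (the row code). -/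
def IsTensorCode {F : Type*} [Field F] {m n : ℕ} (a b : ℕ)
    (C : Submodule F (Matrix (Fin m) (Fin n) F)) : Prop :=
  ∃ (Ccol : Submodule F (Fin m → F)) (Crow : Submodule F (Fin n → F)),
    Module.finrank F Ccol + a = m ∧ Module.finrank F Crow + b = n ∧ C = tensorCode Ccol Crow

/-- The erasure pattern `E` is correctable by `C`: a codeword is determined by its entries
outside `E`. -/
def Correctable {F : Type*} [Field F] {m n : ℕ} (C : Submodule F (Matrix (Fin m) (Fin n) F))
    (E : Finset (Fin m × Fin n)) : Prop :=
  ∀ X ∈ C, ∀ Y ∈ C, (∀ i j, (i, j) ∉ E → X i j = Y i j) → X = Y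

/-- `E` is correctable for the topology: some `(m, n, a, b)`-tensor code, over some field,
corrects it. -/
def TopologyCorrectable {m n : ℕ} (a b : ℕ) (E : Finset (Fin m × Fin n)) : Prop :=
  ∃ (K : Type) (_ : Field K) (C : Submodule K (Matrix (Fin m) (Fin n) K)),
    IsTensorCode a b C ∧ Correctable C E

/-- `C` is an `(m, n, a, b)`-MR (maximally recoverable) tensor code: it corrects every erasure
pattern that some `(m, n, a, b)`-tensor code corrects. -/
def IsMRTensorCode {F : Type*} [Field F] {m n : ℕ} (a b : ℕ)
    (C : Submodule F (Matrix (Fin m) (Fin n) F)) : Prop :=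
  IsTensorCode a b C ∧ ∀ E : Finset (Fin m × Fin n), TopologyCorrectable a b E → Correctable C E

/-! ### A word RAM with a step count

A deterministic random access machine: registers addressed by constants of the program, and a
memory addressed through registers.  Programs are built from unit-cost instructions by sequencing,
branching and loops.  All words that a program writes have to be smaller than the bound `W`. -/

namespace WordRAM

structure State where
  reg : ℕ → ℕ
  mem : ℕ → ℕ

/-- The unit-cost instructions; the first argument (of all but `store`) is the target register. -/
inductive Instr where
  /-- `r := c` -/
  | const (r c : ℕ)
  /-- `r := s` -/
  | move (r s : ℕ)
  /-- `r := s + t` -/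
  | add (r s t : ℕ)
  /-- `r := max (s - t) 0` -/
  | sub (r s t : ℕ)
  /-- `r := s * t` -/
  | mul (r s t : ℕ)
  /-- `r := mem[s]` -/
  | load (r s : ℕ)
  /-- `mem[r] := s` -/
  | store (r s : ℕ)

/-- The word written by an instruction. -/
def Instr.value (σ : State) : Instr → ℕ
  | const _ c => c
  | move _ s => σ.reg s
  | add _ s t => σ.reg s + σ.reg t
  | sub _ s t => σ.reg s - σ.reg t
  | mul _ s t => σ.reg s * σ.reg t
  | load _ s => σ.mem (σ.reg s)
  | store _ s => σ.reg s

def State.setReg (σ : State) (r v : ℕ) : State := ⟨Function.update σ.reg r v, σ.mem⟩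

def State.setMem (σ : State) (k v : ℕ) : State := ⟨σ.reg, Function.update σ.mem k v⟩

/-- The effect of an instruction. -/
def Instr.apply (i : Instr) (σ : State) : State :=
  match i with
  | const r _ | move r _ | add r _ _ | sub r _ _ | mul r _ _ | load r _ => σ.setReg r (i.value σ)
  | store r _ => σ.setMem (σ.reg r) (i.value σ)

inductive Prog where
  | instr (i : Instr)
  | seq (p q : Prog)
  /-- run `p` if register `r` is nonzero, and `q` otherwise -/
  | ite (r : ℕ) (p q : Prog)
  /-- run `p` as long as register `r` is nonzero -/
  | while (r : ℕ) (p : Prog)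

/-- `Exec W P σ τ t`: started in state `σ`, the program `P` halts in state `τ` after exactly `t`
steps (each instruction and each test of a register being one step), and every word written on the
way is smaller than `W`. -/
inductive Exec (W : ℕ) : Prog → State → State → ℕ → Prop
  | instr (i : Instr) (σ : State) (h : i.value σ < W) : Exec W (.instr i) σ (i.apply σ) 1
  | seq {p q : Prog} {σ τ υ : State} {s t : ℕ} (hp : Exec W p σ τ s) (hq : Exec W q τ υ t) :
      Exec W (.seq p q) σ υ (s + t)
  | ite_true {r : ℕ} {p q : Prog} {σ τ : State} {t : ℕ} (h : σ.reg r ≠ 0) (hp : Exec W p σ τ t) :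
      Exec W (.ite r p q) σ τ (t + 1)
  | ite_false {r : ℕ} {p q : Prog} {σ τ : State} {t : ℕ} (h : σ.reg r = 0) (hq : Exec W q σ τ t) :
      Exec W (.ite r p q) σ τ (t + 1)
  | while_true {r : ℕ} {p : Prog} {σ τ υ : State} {s t : ℕ} (h : σ.reg r ≠ 0)
      (hp : Exec W p σ τ s) (hw : Exec W (.while r p) τ υ t) :
      Exec W (.while r p) σ υ (s + t + 1)
  | while_false {r : ℕ} {p : Prog} {σ : State} (h : σ.reg r = 0) : Exec W (.while r p) σ σ 1

/-- The machine is deterministic. -/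
theorem Exec.deterministic {W W' : ℕ} {P : Prog} {σ τ τ' : State} {t t' : ℕ}
    (h : Exec W P σ τ t) (h' : Exec W' P σ τ' t') : τ = τ' ∧ t = t' := by
  induction h generalizing τ' t' with
  | instr i σ _ => cases h'; exact ⟨rfl, rfl⟩
  | seq _ _ ihp ihq =>
    cases h' with
    | seq hp' hq' =>
      obtain ⟨rfl, rfl⟩ := ihp hp'
      obtain ⟨rfl, rfl⟩ := ihq hq'
      exact ⟨rfl, rfl⟩
  | ite_true h _ ih =>
    cases h' with
    | ite_true _ hp' => obtain ⟨rfl, rfl⟩ := ih hp'; exact ⟨rfl, rfl⟩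
    | ite_false h0 _ => exact absurd h0 h
  | ite_false h _ ih =>
    cases h' with
    | ite_true h0 _ => exact absurd h h0
    | ite_false _ hq' => obtain ⟨rfl, rfl⟩ := ih hq'; exact ⟨rfl, rfl⟩
  | while_true h _ _ ihp ihw =>
    cases h' with
    | while_true _ hp' hw' =>
      obtain ⟨rfl, rfl⟩ := ihp hp'
      obtain ⟨rfl, rfl⟩ := ihw hw'
      exact ⟨rfl, rfl⟩
    | while_false h0 => exact absurd h0 h
  | while_false h =>
    cases h' with
    | while_true h0 _ _ => exact absurd h h0
    | while_false _ => exact ⟨rfl, rfl⟩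

end WordRAM

open Classical in
/-- The input `(m, n, b, E)`: registers `0, 1, 2` hold `m, n, b`, and the memory holds the
`0/1` matrix of `E` row by row; everything else is zero. -/
noncomputable def inputState (m n b : ℕ) (E : Finset (Fin m × Fin n)) : WordRAM.State where
  reg k := if k = 0 then m else if k = 1 then n else if k = 2 then b else 0
  mem k := if ∃ (i : Fin m) (j : Fin n), (i, j) ∈ E ∧ k = (i : ℕ) * n + (j : ℕ) then 1 else 0

/-! ### Regular families of supports -/

/-! Everything passes through one combinatorial condition, `Regular`, on the supports `R i` of the
rows of `E`. It is equivalent to correctability by some code and to correctability by any given MR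
code, and it can be tested by bipartite matching.

Necessity, over every field: let `S` be a set of rows and `T` the union of their supports. Since the
column code is cut out by one equation with weights `w`, the map `x ↦ ∑ w i • x i` from the sum of
the spaces of row codewords supported on the `R i` to the row codewords supported on `T` is
injective: a kernel element is a codeword erased by `E`. Comparing dimensions, with at most `b`
check equations on each support, gives the inequality.

Sufficiency, over `ℚ`: take the single check `∑ x i = 0` for columns, and for rows the span of a
generic matrix with `#(R i) - b` rows supported on `R i`, padded by unrestricted rows to `n - b` in
all. Regularity and Hall's theorem make all maximal minors nonzero. Hence a codeword supported on `R
i` combines only the generators of block `i`. Blocks of different rows are disjoint, so the column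
equation kills every coefficient of a codeword erased by `E`.

Algorithm: for each heavy row `i₀` (more than `b` erasures), charging the extra `b` to `i₀` turns
regularity for the sets containing `i₀` into Hall's condition with demands. An auction decides it: a
row in need takes its cheapest column, raising the price by one and displacing the holder. Prices
stop at `n`, so there are at most `n * n` sales of linear cost; a row priced out exhibits a
violation of Hall's condition (`IsAuction.not_hallCondition`).

Number of tests: a failed test ends the run. For `b = 0` all tests coincide, so one suffices. For `b
≥ 1` a successful test shows that there are at most `n - b ≤ n.choose b` heavy rows. -/

/-- The erased columns of row `i`. -/
def rowSupport {m n : ℕ} (E : Finset (Fin m × Fin n)) (i : Fin m) : Finset (Fin n) :=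
  Finset.univ.filter fun j => (i, j) ∈ E

theorem mem_rowSupport {m n : ℕ} {E : Finset (Fin m × Fin n)} {i : Fin m} {j : Fin n} :
    j ∈ rowSupport E i ↔ (i, j) ∈ E := by
  simp [rowSupport]

/-- Any rows with more than `b` erasures have, in total, at least `b` more columns than the sum of
their excesses over `b`. -/
def Regular {m n : ℕ} (b : ℕ) (R : Fin m → Finset (Fin n)) : Prop :=
  ∀ S : Finset (Fin m), S.Nonempty → (∀ i ∈ S, b < (R i).card) →
    ∑ i ∈ S, ((R i).card - b) + b ≤ (S.biUnion R).card

/-! ### Regularity is necessary -/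

section Necessity

variable {F : Type*} [Field F] {m n : ℕ}

/-- The vectors supported on `T`. -/
def supportedOn (F : Type*) [Field F] {n : ℕ} (T : Finset (Fin n)) : Submodule F (Fin n → F) where
  carrier := {x | ∀ j ∉ T, x j = 0}
  add_mem' hx hy j hj := by simp [hx j hj, hy j hj]
  zero_mem' _ _ := rfl
  smul_mem' c x hx j hj := by simp [hx j hj]

theorem supportedOn_mono {T T' : Finset (Fin n)} (h : T ⊆ T') :
    supportedOn F T ≤ supportedOn F T' :=
  fun _ hx j hj => hx j fun hj' => hj (h hj')

theorem finrank_supportedOn (T : Finset (Fin n)) :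
    Module.finrank F (supportedOn F T) = T.card := by
  have e : supportedOn F T ≃ₗ[F] (T → F) :=
    { toFun := fun x j => x.1 j
      invFun := fun y => ⟨fun j => if h : j ∈ T then y ⟨j, h⟩ else 0, fun j hj => by simp [hj]⟩
      map_add' := fun _ _ => rfl
      map_smul' := fun _ _ => rfl
      left_inv := fun x => by
        ext j
        by_cases h : j ∈ T
        · simp [h]
        · simp [h, x.2 j h]
      right_inv := fun y => by ext j; simp }
  rw [e.finrank_eq]
  simp

/-- The rank of the columns `T` of a parity check matrix of `C`. -/
noncomputable def checkRank (C : Submodule F (Fin n → F)) (T : Finset (Fin n)) : ℕ :=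
  Module.finrank F ((supportedOn F T).map C.mkQ)

theorem checkRank_mono (C : Submodule F (Fin n → F)) {T T' : Finset (Fin n)} (h : T ⊆ T') :
    checkRank C T ≤ checkRank C T' :=
  Submodule.finrank_mono (Submodule.map_mono (supportedOn_mono h))

theorem checkRank_le {C : Submodule F (Fin n → F)} {b : ℕ} (hC : Module.finrank F C + b = n)
    (T : Finset (Fin n)) : checkRank C T ≤ b := by
  have h1 := Submodule.finrank_le ((supportedOn F T).map C.mkQ)
  have h2 := Submodule.finrank_quotient_add_finrank C
  simp only [Module.finrank_fin_fun] at h2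
  unfold checkRank
  omega

/-- Rank-nullity for the quotient map by `C`, restricted to the vectors supported on `T`. -/
theorem finrank_inf_supportedOn (C : Submodule F (Fin n → F)) (T : Finset (Fin n)) :
    Module.finrank F (supportedOn F T ⊓ C : Submodule F (Fin n → F)) + checkRank C T = T.card := by
  have h := LinearMap.finrank_range_add_finrank_ker (C.mkQ.domRestrict (supportedOn F T))
  rw [finrank_supportedOn, LinearMap.range_domRestrict, LinearMap.ker_domRestrict,
    Submodule.ker_mkQ] at h
  have h2 : Module.finrank F (C.comap (supportedOn F T).subtype) =
      Module.finrank F (supportedOn F T ⊓ C : Submodule F (Fin n → F)) := by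
    rw [← Submodule.map_comap_subtype]
    exact (Submodule.equivMapOfInjective _ (Submodule.subtype_injective _) _).finrank_eq
  rw [h2] at h
  unfold checkRank
  omega

theorem exists_functional_of_finrank_add_one {C : Submodule F (Fin m → F)}
    (hC : Module.finrank F C + 1 = m) :
    ∃ w : Fin m → F, ∀ x : Fin m → F, ∑ i, w i * x i = 0 → x ∈ C := by
  have h2 := Submodule.finrank_quotient_add_finrank C
  simp only [Module.finrank_fin_fun] at h2
  have h1 : Module.finrank F ((Fin m → F) ⧸ C) = Module.finrank F F := by
    rw [Module.finrank_self]; omega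
  let e := LinearEquiv.ofFinrankEq _ _ h1
  -- The quotient by `C` is a line; the weights are the images of the unit vectors in it.
  refine ⟨fun i => e (C.mkQ (Pi.single i 1)), fun x hx => ?_⟩
  have : e (C.mkQ x) = 0 := by
    rw [← hx, ← Finset.univ_sum_single x, map_sum, map_sum]
    refine Finset.sum_congr rfl fun i _ => ?_
    have : (Pi.single i (x i) : Fin m → F) = x i • Pi.single i 1 := by
      rw [← Pi.single_smul]; simp
    rw [this]
    simp [mul_comm]
  simpa using this

theorem Correctable.eq_zero {C : Submodule F (Matrix (Fin m) (Fin n) F)}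
    {E : Finset (Fin m × Fin n)} (h : Correctable C E) {X : Matrix (Fin m) (Fin n) F} (hX : X ∈ C)
    (hE : ∀ i j, (i, j) ∉ E → X i j = 0) : X = 0 :=
  h X hX 0 C.zero_mem fun i j hij => by simp [hE i j hij]

theorem sum_finrank_le_of_correctable {Ccol : Submodule F (Fin m → F)}
    {Crow : Submodule F (Fin n → F)} (hcol : Module.finrank F Ccol + 1 = m)
    {E : Finset (Fin m × Fin n)} (hE : Correctable (tensorCode Ccol Crow) E)
    (S : Finset (Fin m)) :
    ∑ i ∈ S, Module.finrank F (supportedOn F (rowSupport E i) ⊓ Crow : Submodule F (Fin n → F)) ≤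
      Module.finrank F
        (supportedOn F (S.biUnion (rowSupport E)) ⊓ Crow : Submodule F (Fin n → F)) := by
  obtain ⟨w, hw⟩ := exists_functional_of_finrank_add_one hcol
  let V : S → Submodule F (Fin n → F) := fun i => supportedOn F (rowSupport E i) ⊓ Crow
  let D := supportedOn F (S.biUnion (rowSupport E)) ⊓ Crow
  let f : ((i : S) → V i) →ₗ[F] (Fin n → F) :=
    ∑ i : S, w i • (V i).subtype ∘ₗ LinearMap.proj i
  have hf : ∀ x, f x = ∑ i : S, w i • (x i : Fin n → F) := fun x => by simp [f]
  have hfD : ∀ x, f x ∈ D := fun x => by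
    rw [hf]
    refine Submodule.sum_mem _ fun i _ => Submodule.smul_mem _ _ ⟨?_, (x i).2.2⟩
    exact supportedOn_mono (Finset.subset_biUnion_of_mem (rowSupport E) i.2) (x i).2.1
  have hker : ∀ x, f x = 0 → x = 0 := by
    intro x hx
    -- A kernel element, completed by zero rows outside `S`, is a codeword that vanishes outside
    -- `E`.
    let X : Matrix (Fin m) (Fin n) F := fun i => if h : i ∈ S then (x ⟨i, h⟩ : Fin n → F) else 0
    have hXS : ∀ i : S, X i = (x i : Fin n → F) := fun i => by simp [X]
    have hX : X ∈ tensorCode Ccol Crow := by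
      refine ⟨fun i => ?_, fun j => hw _ ?_⟩
      · by_cases h : i ∈ S
        · have : (fun j => X i j) = (x ⟨i, h⟩ : Fin n → F) := hXS ⟨i, h⟩
          rw [this]
          exact (x ⟨i, h⟩).2.2
        · have : (fun j => X i j) = 0 := by ext j; simp [X, h]
          rw [this]
          exact Crow.zero_mem
      · have h1 := congrFun hx j
        rw [hf] at h1
        simp only [Finset.sum_apply, Pi.smul_apply, smul_eq_mul, Pi.zero_apply] at h1
        rw [← h1, ← Finset.sum_subset (Finset.subset_univ S), ← Finset.sum_coe_sort S]
        · exact Finset.sum_congr rfl fun i _ => by rw [hXS]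
        · intro i _ hi
          simp [X, hi]
    have h0 := hE.eq_zero hX fun i j hij => by
      by_cases h : i ∈ S
      · have := (x ⟨i, h⟩).2.1 j (by simpa [mem_rowSupport] using hij)
        simpa [X, h] using this
      · simp [X, h]
    ext i j
    have := congrFun (congrFun h0 i) j
    rw [hXS] at this
    simpa using this
  have hinj : Function.Injective (f.codRestrict D hfD) := by
    rw [← LinearMap.ker_eq_bot, LinearMap.ker_codRestrict, LinearMap.ker_eq_bot']
    exact hker
  have h := LinearMap.finrank_le_finrank_of_injective hinj
  rw [Module.finrank_pi_fintype] at h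
  rw [← Finset.sum_coe_sort S]
  exact h

/-- With `ρ = checkRank Crow`, the dimension inequality reads `∑ (#(R i) - ρ(R i)) ≤ #T - ρ(T)`.
Replacing each `ρ(R i)` by `ρ(T)` leaves `#S - 1` copies of `ρ(T) ≤ b` on the right. -/
theorem regular_of_correctable {b : ℕ} {C : Submodule F (Matrix (Fin m) (Fin n) F)}
    (hC : IsTensorCode 1 b C) {E : Finset (Fin m × Fin n)} (hE : Correctable C E) :
    Regular b (rowSupport E) := by
  obtain ⟨Ccol, Crow, hcol, hrow, rfl⟩ := hC
  intro S hS hb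
  have h := sum_finrank_le_of_correctable hcol hE S
  set T := S.biUnion (rowSupport E) with hT
  have hTr := finrank_inf_supportedOn Crow T
  have hTb := checkRank_le hrow T
  have h1 : ∑ i ∈ S, (rowSupport E i).card ≤ Module.finrank F
      (supportedOn F T ⊓ Crow : Submodule F (Fin n → F)) + S.card * checkRank Crow T := by
    calc ∑ i ∈ S, (rowSupport E i).card
        ≤ ∑ i ∈ S, (Module.finrank F
            (supportedOn F (rowSupport E i) ⊓ Crow : Submodule F (Fin n → F)) +
              checkRank Crow T) := by
          refine Finset.sum_le_sum fun i hi => ?_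
          have h2 := finrank_inf_supportedOn Crow (rowSupport E i)
          have h3 : checkRank Crow (rowSupport E i) ≤ checkRank Crow T :=
            checkRank_mono Crow (Finset.subset_biUnion_of_mem (rowSupport E) hi)
          omega
      _ ≤ _ := by
          rw [Finset.sum_add_distrib, Finset.sum_const, smul_eq_mul]
          omega
  have h2 : ∑ i ∈ S, ((rowSupport E i).card - b) + S.card * b =
      ∑ i ∈ S, (rowSupport E i).card := by
    rw [← smul_eq_mul, ← Finset.sum_const, ← Finset.sum_add_distrib]
    exact Finset.sum_congr rfl fun i hi => by have := hb i hi; omega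
  obtain ⟨s, hs⟩ : ∃ s, S.card = s + 1 := ⟨S.card - 1, by have := hS.card_pos; omega⟩
  have h3 : s * checkRank Crow T ≤ s * b := Nat.mul_le_mul_left _ hTb
  rw [hs] at h1 h2
  rw [add_mul, one_mul] at h1 h2
  omega

end Necessity

/-! ### Regularity is sufficient -/

section Sufficiency

/-- A generic matrix with prescribed row supports, any nonempty set `I` of which covers at least
`#I + b` columns, has only nonzero maximal minors. -/
theorem exists_matrix_minors_ne_zero {ι : Type*} [Fintype ι] [DecidableEq ι] {n b : ℕ}
    (hι : Fintype.card ι + b = n) (R : ι → Finset (Fin n))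
    (hR : ∀ I : Finset ι, I.Nonempty → I.card + b ≤ (I.biUnion R).card) :
    ∃ G : Matrix ι (Fin n) ℚ, (∀ x, ∀ j ∉ R x, G x j = 0) ∧
      ∀ f : ι ↪ Fin n, (G.submatrix id f).det ≠ 0 := by
  let P : Matrix ι (Fin n) (MvPolynomial (ι × Fin n) ℚ) :=
    Matrix.of fun x j => if j ∈ R x then MvPolynomial.X (x, j) else 0
  have hP : ∀ v : ι × Fin n → ℚ, ∀ f : ι ↪ Fin n,
      MvPolynomial.eval v (P.submatrix id f).det =
        (Matrix.det fun x y => if f y ∈ R x then v (x, f y) else 0) := by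
    intro v f
    rw [RingHom.map_det]
    congr 1
    ext x y
    simp only [P, RingHom.mapMatrix_apply, Matrix.map_apply, Matrix.submatrix_apply,
      Matrix.of_apply, id]
    split_ifs <;> simp
  have hne : ∀ f : ι ↪ Fin n, (P.submatrix id f).det ≠ 0 := by
    intro f h0
    -- The chosen columns miss only `b` columns, so the surplus `b` in `hR` leaves Hall's condition
    -- inside them.
    obtain ⟨g, hg, hgR⟩ := (Finset.all_card_le_biUnion_card_iff_exists_injective
      fun x => R x ∩ Finset.univ.map f).1 fun I => by
        rcases I.eq_empty_or_nonempty with rfl | hI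
        · simp
        have h1 := hR I hI
        have h2 : I.biUnion (fun x => R x ∩ Finset.univ.map f) =
            I.biUnion R ∩ Finset.univ.map f := by
          ext j
          simp only [Finset.mem_biUnion, Finset.mem_inter]
          tauto
        have h3 := Finset.card_union_add_card_inter (I.biUnion R) (Finset.univ.map f)
        have h4 := Finset.card_le_univ (I.biUnion R ∪ Finset.univ.map f)
        rw [Finset.card_map, Finset.card_univ] at h3
        rw [Fintype.card_fin] at h4
        rw [h2]
        omega
    have hgf : ∀ x, ∃ y, f y = g x := fun x => by
      have := (Finset.mem_inter.1 (hgR x)).2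
      simpa using this
    choose p hp using hgf
    have hpi : Function.Injective p := fun x y hxy => hg (by rw [← hp, ← hp, hxy])
    let π := Equiv.ofBijective p (Finite.injective_iff_bijective.1 hpi)
    -- At the indicator of the matching `g` the matrix becomes a permutation matrix, of determinant
    -- `±1`.
    have h1 := hP (fun z => if z.2 = g z.1 then 1 else 0) f
    rw [h0, map_zero] at h1
    have h2 : (fun x y => if f y ∈ R x then (if f y = g x then (1 : ℚ) else 0) else 0 :
        Matrix ι ι ℚ) = (1 : Matrix ι ι ℚ).submatrix π id := by
      ext x y
      simp only [Matrix.submatrix_apply, id, Matrix.one_apply, π, Equiv.ofBijective_apply]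
      by_cases hxy : p x = y
      · subst hxy
        simp [hp, (Finset.mem_inter.1 (hgR x)).1]
      · have : f y ≠ g x := fun h => hxy (f.injective (by rw [hp, h]))
        simp [hxy, this]
    simp only at h1
    rw [h2, Matrix.det_permute] at h1
    rcases Int.units_eq_one_or (Equiv.Perm.sign π) with h | h <;> simp [h] at h1
  have hprod : ∏ f : ι ↪ Fin n, (P.submatrix id f).det ≠ 0 :=
    Finset.prod_ne_zero_iff.2 fun f _ => hne f
  obtain ⟨v, hv⟩ : ∃ v, MvPolynomial.eval v (∏ f : ι ↪ Fin n, (P.submatrix id f).det) ≠ 0 := by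
    by_contra! h
    exact hprod (MvPolynomial.funext fun v => by rw [h v, map_zero])
  rw [map_prod, Finset.prod_ne_zero_iff] at hv
  refine ⟨fun x j => if j ∈ R x then v (x, j) else 0, fun x j hj => by simp [hj], fun f => ?_⟩
  have := hv f (Finset.mem_univ _)
  rwa [hP] at this

/-- If all maximal minors of `G` are nonzero, and the rows of `G` in `A` vanish on `Z`, where
`#Aᶜ ≤ #Z`, then every combination of rows that vanishes on `Z` involves only the rows in `A`. -/
theorem coeff_eq_zero_of_vanishing {ι : Type*} [Fintype ι] [DecidableEq ι] {n : ℕ}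
    (hn : Fintype.card ι ≤ n) {G : Matrix ι (Fin n) ℚ}
    (hG : ∀ f : ι ↪ Fin n, (G.submatrix id f).det ≠ 0) {A : Finset ι} {Z : Finset (Fin n)}
    (hAZ : Aᶜ.card ≤ Z.card) (hA : ∀ x ∈ A, ∀ j ∈ Z, G x j = 0) {c : ι → ℚ}
    (hc : ∀ j ∈ Z, Matrix.vecMul c G j = 0) : ∀ x ∉ A, c x = 0 := by
  -- Choose a maximal minor whose columns indexed by `Aᶜ` lie in `Z`; the columns indexed by `A` are
  -- arbitrary.
  obtain ⟨f, hf, hfZ⟩ := (Finset.all_card_le_biUnion_card_iff_exists_injective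
    fun x => if x ∈ A then (Finset.univ : Finset (Fin n)) else Z).1 fun I => by
      by_cases hI : ∃ x ∈ I, x ∈ A
      · obtain ⟨x, hxI, hxA⟩ := hI
        have h1 := Finset.card_le_card (Finset.subset_biUnion_of_mem
          (fun x => if x ∈ A then (Finset.univ : Finset (Fin n)) else Z) hxI)
        simp only [hxA, if_true, Finset.card_univ, Fintype.card_fin] at h1
        exact (I.card_le_univ.trans hn).trans h1
      · push Not at hI
        rcases I.eq_empty_or_nonempty with rfl | ⟨x, hx⟩
        · simp
        have h1 := Finset.card_le_card (Finset.subset_biUnion_of_mem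
          (fun x => if x ∈ A then (Finset.univ : Finset (Fin n)) else Z) hx)
        simp only [hI x hx, if_false] at h1
        have h2 : I.card ≤ Aᶜ.card := Finset.card_le_card fun y hy => by simpa using hI y hy
        omega
  let N := G.submatrix id f
  have hN : N.det ≠ 0 := hG ⟨f, hf⟩
  have hNinj : Function.Injective (Matrix.vecMulLinear N) := by
    rw [← LinearMap.ker_eq_bot, LinearMap.ker_eq_bot']
    exact fun v hv => Matrix.eq_zero_of_vecMul_eq_zero hN hv
  let U : Submodule ℚ (ι → ℚ) :=
    { carrier := {v | ∀ x ∉ A, v x = 0}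
      add_mem' := fun hv hw x hx => by simp [hv x hx, hw x hx]
      zero_mem' := fun _ _ => rfl
      smul_mem' := fun a v hv x hx => by simp [hv x hx] }
  -- `N` is block triangular: it preserves the vectors supported on `A`, and being injective it maps
  -- them onto themselves. So `c` lies there as soon as its image does.
  have hUle : U.map (Matrix.vecMulLinear N) ≤ U := by
    rintro _ ⟨v, hv, rfl⟩ y hy
    have hyZ : f y ∈ Z := by simpa [hy] using hfZ y
    rw [Matrix.vecMulLinear_apply]
    refine Finset.sum_eq_zero fun x _ => ?_
    by_cases hx : x ∈ A
    · simp [N, hA x hx _ hyZ]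
    · simp [hv x hx]
  have hUeq : U.map (Matrix.vecMulLinear N) = U :=
    Submodule.eq_of_le_of_finrank_eq hUle
      (Submodule.equivMapOfInjective _ hNinj U).finrank_eq.symm
  have hcU : Matrix.vecMulLinear N c ∈ U := by
    intro y hy
    have hyZ : f y ∈ Z := by simpa [hy] using hfZ y
    exact hc _ hyZ
  rw [← hUeq] at hcU
  obtain ⟨v, hv, hvc⟩ := hcU
  exact hNinj hvc ▸ hv

theorem Regular.sum_le {m n b : ℕ} {R : Fin m → Finset (Fin n)} (h : Regular b R) (hb : b ≤ n) :
    ∑ i, ((R i).card - b) + b ≤ n := by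
  have h1 : ∑ i, ((R i).card - b) =
      ∑ i ∈ Finset.univ.filter (fun i => b < (R i).card), ((R i).card - b) := by
    symm
    refine Finset.sum_subset (Finset.subset_univ _) fun i _ hi => ?_
    simp only [Finset.mem_filter, Finset.mem_univ, true_and, not_lt] at hi
    omega
  rcases (Finset.univ.filter (fun i => b < (R i).card)).eq_empty_or_nonempty with h0 | h0
  · rw [h1, h0]
    simpa using hb
  · rw [h1]
    refine (h _ h0 fun i hi => by simpa using hi).trans ?_
    exact (Finset.card_le_univ _).trans (by simp)

theorem finrank_sum_eq_zero {m : ℕ} (hm : 1 ≤ m) :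
    Module.finrank ℚ (LinearMap.ker (∑ i : Fin m, LinearMap.proj (R := ℚ) (φ := fun _ => ℚ) i)) + 1
      = m := by
  set s := ∑ i : Fin m, LinearMap.proj (R := ℚ) (φ := fun _ => ℚ) i with hs
  have h := LinearMap.finrank_range_add_finrank_ker s
  have h1 : LinearMap.range s = ⊤ := by
    rw [LinearMap.range_eq_top]
    intro a
    refine ⟨Pi.single ⟨0, hm⟩ a, ?_⟩
    simp [hs, Finset.sum_apply]
  rw [h1, finrank_top] at h
  simp only [Module.finrank_self, Module.finrank_fin_fun] at h
  omega

theorem topologyCorrectable_of_regular {m n b : ℕ} (hm : 1 ≤ m) (hb : b ≤ n)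
    {E : Finset (Fin m × Fin n)} (hE : Regular b (rowSupport E)) : TopologyCorrectable 1 b E := by
  have hsum := hE.sum_le hb
  let R := rowSupport E
  -- One block of generators per row, empty if the row is not heavy, and padding up to `n - b`;
  -- `hsum` makes the subtraction exact.
  let ι := (Σ i : Fin m, Fin ((R i).card - b)) ⊕ Fin (n - b - ∑ i, ((R i).card - b))
  have hι : Fintype.card ι + b = n := by
    simp only [ι, Fintype.card_sum, Fintype.card_sigma, Fintype.card_fin]
    simp only [R]
    omega
  let Q : ι → Finset (Fin n) := Sum.elim (fun x => R x.1) fun _ => Finset.univ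
  have hQ : ∀ I : Finset ι, I.Nonempty → I.card + b ≤ (I.biUnion Q).card := by
    intro I hI
    by_cases hr : ∃ y, Sum.inr y ∈ I
    · obtain ⟨y, hy⟩ := hr
      have h1 := Finset.card_le_card (Finset.subset_biUnion_of_mem Q hy)
      simp only [Q, Sum.elim_inr, Finset.card_univ, Fintype.card_fin] at h1
      have h2 := I.card_le_univ
      simp only [Q]
      omega
    -- Without padding rows, `I` may be enlarged to the full blocks it meets: its columns do not
    -- change, and regularity of the corresponding heavy rows applies.
    · let S : Finset (Fin m) := Finset.univ.filter fun i => ∃ k, Sum.inl ⟨i, k⟩ ∈ I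
      have hIsub : I ⊆ (S.sigma fun i => (Finset.univ : Finset (Fin ((R i).card - b)))).map
          ⟨Sum.inl, Sum.inl_injective⟩ := by
        rintro (⟨i, k⟩ | y) hx
        · simp only [Finset.mem_map, Finset.mem_sigma, Function.Embedding.coeFn_mk]
          exact ⟨⟨i, k⟩, ⟨by simpa [S] using ⟨k, hx⟩, Finset.mem_univ _⟩, rfl⟩
        · exact absurd ⟨y, hx⟩ hr
      have h1 := Finset.card_le_card hIsub
      rw [Finset.card_map, Finset.card_sigma] at h1
      simp only [Finset.card_univ, Fintype.card_fin] at h1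
      have hSne : S.Nonempty := by
        obtain ⟨x, hx⟩ := hI
        obtain ⟨y, hy, -⟩ := Finset.mem_map.1 (hIsub hx)
        exact ⟨y.1, (Finset.mem_sigma.1 hy).1⟩
      have h2 := hE S hSne fun i hi => by
        obtain ⟨k, -⟩ : ∃ k, Sum.inl ⟨i, k⟩ ∈ I := by simpa [S] using hi
        have := k.2
        simp only [R] at this
        omega
      have h3 : S.biUnion R ⊆ I.biUnion Q := by
        intro j hj
        obtain ⟨i, hi, hij⟩ := Finset.mem_biUnion.1 hj
        obtain ⟨k, hk⟩ : ∃ k, Sum.inl ⟨i, k⟩ ∈ I := by simpa [S] using hi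
        exact Finset.mem_biUnion.2 ⟨_, hk, hij⟩
      have h4 := Finset.card_le_card h3
      simp only [R] at h1 h4
      omega
  obtain ⟨G, hG0, hG⟩ := exists_matrix_minors_ne_zero hι Q hQ
  have hcard : Fintype.card ι ≤ n := by omega
  have hGinj : Function.Injective (Matrix.vecMulLinear G) := by
    rw [← LinearMap.ker_eq_bot, LinearMap.ker_eq_bot']
    intro c hc
    funext x
    refine coeff_eq_zero_of_vanishing hcard hG (A := ∅) (Z := Finset.univ) ?_ (by simp)
      (fun j _ => congrFun hc j) x (by simp)
    rw [Finset.compl_empty, Finset.card_univ, Finset.card_univ, Fintype.card_fin]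
    exact hcard
  let Ccol := LinearMap.ker (∑ i : Fin m, LinearMap.proj (R := ℚ) (φ := fun _ => ℚ) i)
  let Crow := LinearMap.range (Matrix.vecMulLinear G)
  have hcol : ∀ x : Fin m → ℚ, x ∈ Ccol → ∑ i, x i = 0 := fun x hx => by
    simpa [Ccol, Finset.sum_apply] using hx
  refine ⟨ℚ, inferInstance, tensorCode Ccol Crow,
    ⟨Ccol, Crow, finrank_sum_eq_zero hm, ?_, rfl⟩, ?_⟩
  · rw [LinearMap.finrank_range_of_inj hGinj, Module.finrank_fintype_fun_eq_card]
    exact hι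
  have key : ∀ X ∈ tensorCode Ccol Crow, (∀ i j, (i, j) ∉ E → X i j = 0) → X = 0 := by
    intro X hX hXE
    choose c hc using hX.1
    have hcA : ∀ i, ∀ x, (∀ k, x ≠ Sum.inl ⟨i, k⟩) → c i x = 0 := by
      intro i x hx
      let A : Finset ι := Finset.univ.map
        ⟨fun k : Fin ((R i).card - b) => Sum.inl (⟨i, k⟩ : Σ i : Fin m, Fin ((R i).card - b)),
          fun k k' h => by simpa using Sum.inl.inj h⟩
      have hAc : A.card = (R i).card - b := by simp [A]
      refine coeff_eq_zero_of_vanishing hcard hG (A := A) (Z := (R i)ᶜ) ?_ ?_ ?_ x ?_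
      · rw [Finset.card_compl, Finset.card_compl, hAc, Fintype.card_fin]
        have := (R i).card_le_univ
        rw [Fintype.card_fin] at this
        omega
      · intro y hy j hj
        obtain ⟨k, -, rfl⟩ := Finset.mem_map.1 hy
        exact hG0 _ j (Finset.mem_compl.1 hj)
      · intro j hj
        have h1 := congrFun (hc i) j
        rw [Matrix.vecMulLinear_apply] at h1
        rw [h1]
        exact hXE i j (by simpa [R, mem_rowSupport] using hj)
      · intro hxA
        obtain ⟨k, -, hk⟩ := Finset.mem_map.1 hxA
        exact hx k hk.symm
    have hsum0 : ∑ i, c i = 0 := by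
      apply hGinj
      rw [map_sum, map_zero]
      funext j
      rw [Finset.sum_apply]
      simp only [hc]
      exact hcol _ (hX.2 j)
    have hc0 : ∀ i, c i = 0 := by
      intro i
      funext x
      by_cases hx : ∃ k, x = Sum.inl ⟨i, k⟩
      · obtain ⟨k, rfl⟩ := hx
        have h1 := congrFun hsum0 (Sum.inl ⟨i, k⟩)
        -- Only row `i` can have a nonzero coefficient at a generator of block `i`.
        rw [Finset.sum_apply, Finset.sum_eq_single i] at h1
        · exact h1
        · intro i' _ hi'
          refine hcA i' _ fun k' hk' => hi' ?_
          exact (congrArg Sigma.fst (Sum.inl.inj hk')).symm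
        · simp
      · push Not at hx
        exact hcA i x hx
    ext i j
    have h1 := congrFun (hc i) j
    rw [hc0, map_zero] at h1
    exact h1.symm
  intro X hX Y hY hXY
  exact sub_eq_zero.1 (key (X - Y) (Submodule.sub_mem _ hX hY) fun i j hij => by
    simp [hXY i j hij])

theorem topologyCorrectable_iff_regular {m n b : ℕ} (hm : 1 ≤ m) (hb : b ≤ n)
    (E : Finset (Fin m × Fin n)) : TopologyCorrectable 1 b E ↔ Regular b (rowSupport E) :=
  ⟨fun ⟨_, _, _, hC, hE⟩ => regular_of_correctable hC hE, topologyCorrectable_of_regular hm hb⟩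

theorem IsMRTensorCode.correctable_iff_regular {F : Type*} [Field F] {m n b : ℕ} (hm : 1 ≤ m)
    (hb : b ≤ n) {C : Submodule F (Matrix (Fin m) (Fin n) F)} (hC : IsMRTensorCode 1 b C)
    (E : Finset (Fin m × Fin n)) : Correctable C E ↔ Regular b (rowSupport E) :=
  ⟨regular_of_correctable hC.1, fun h => hC.2 E (topologyCorrectable_of_regular hm hb h)⟩

end Sufficiency

/-! ### Hall's condition with demands, decided by an auction -/

section Auction

variable {m n : ℕ}

/-- The rows `i` can be given disjoint sets of `D i` columns from `R i`, by Hall's theorem. -/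
def HallCondition (D : Fin m → ℕ) (R : Fin m → Finset (Fin n)) : Prop :=
  ∀ S : Finset (Fin m), ∑ i ∈ S, D i ≤ (S.biUnion R).card

/-- The demand of row `i` in the test of regularity for the sets of rows that contain `i₀`. -/
def demand (b : ℕ) (R : Fin m → Finset (Fin n)) (i₀ i : Fin m) : ℕ :=
  if i = i₀ then (R i).card else (R i).card - b

theorem sum_demand_of_mem {b : ℕ} {R : Fin m → Finset (Fin n)} {i₀ : Fin m} (h₀ : b < (R i₀).card)
    {S : Finset (Fin m)} (hS : i₀ ∈ S) :
    ∑ i ∈ S, demand b R i₀ i = ∑ i ∈ S, ((R i).card - b) + b := by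
  rw [← Finset.add_sum_erase _ _ hS, ← Finset.add_sum_erase _ (fun i => (R i).card - b) hS]
  have : ∑ i ∈ S.erase i₀, demand b R i₀ i = ∑ i ∈ S.erase i₀, ((R i).card - b) :=
    Finset.sum_congr rfl fun i hi => by simp [demand, Finset.ne_of_mem_erase hi]
  rw [this]
  simp only [demand, if_true]
  omega

/-- Rows that are not heavy demand nothing and can be dropped from `S`. For a set of heavy rows, the
demands add up to the left side of regularity if `i₀` belongs to it, and to `b` less otherwise. -/
theorem regular_iff_hallCondition {b : ℕ} {R : Fin m → Finset (Fin n)} :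
    Regular b R ↔ ∀ i₀, b < (R i₀).card → HallCondition (demand b R i₀) R := by
  constructor
  · intro h i₀ h₀ S
    let S' := S.filter fun i => b < (R i).card
    have h1 : ∑ i ∈ S, demand b R i₀ i = ∑ i ∈ S', demand b R i₀ i := by
      symm
      refine Finset.sum_subset (Finset.filter_subset _ _) fun i hi hi' => ?_
      have hle : (R i).card ≤ b := by simpa [S', hi] using hi'
      have hne : i ≠ i₀ := by rintro rfl; omega
      simp only [demand, hne, if_false]
      omega
    have h2 : (S'.biUnion R).card ≤ (S.biUnion R).card :=
      Finset.card_le_card (Finset.biUnion_subset_biUnion_of_subset_left _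
        (Finset.filter_subset _ _))
    rw [h1]
    refine le_trans ?_ h2
    rcases S'.eq_empty_or_nonempty with h0 | h0
    · simp [h0]
    have h3 := h S' h0 fun i hi => (Finset.mem_filter.1 hi).2
    by_cases hi₀ : i₀ ∈ S'
    · rwa [sum_demand_of_mem h₀ hi₀]
    · have : ∑ i ∈ S', demand b R i₀ i = ∑ i ∈ S', ((R i).card - b) :=
        Finset.sum_congr rfl fun i hi => by
          have : i ≠ i₀ := by rintro rfl; exact hi₀ hi
          simp [demand, this]
      omega
  · rintro h S ⟨i₀, hi₀⟩ hb
    rw [← sum_demand_of_mem (hb i₀ hi₀) hi₀]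
    exact h i₀ (hb i₀ hi₀) S

/-- For `b = 0` the demands do not depend on `i₀`, so a single test decides regularity. -/
theorem demand_zero (R : Fin m → Finset (Fin n)) (i₀ : Fin m) :
    demand 0 R i₀ = fun i => (R i).card := by
  funext i
  simp [demand]

/-! ### Bounding the number of heavy rows -/

/-- Each heavy row demands at least one column and `i₀` demands `b` more; all of them fit into `n`
columns. -/
theorem card_filter_add_le_of_hallCondition {b : ℕ} {R : Fin m → Finset (Fin n)} {i₀ : Fin m}
    (h₀ : b < (R i₀).card) (h : HallCondition (demand b R i₀) R) :
    (Finset.univ.filter fun i => b < (R i).card).card + b ≤ n := by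
  have h1 := h (Finset.univ.filter fun i => b < (R i).card)
  rw [sum_demand_of_mem h₀ (by simpa using h₀)] at h1
  have h2 : (Finset.univ.filter fun i => b < (R i).card).card ≤
      ∑ i ∈ Finset.univ.filter (fun i => b < (R i).card), ((R i).card - b) := by
    rw [Finset.card_eq_sum_ones]
    refine Finset.sum_le_sum fun i hi => ?_
    have : b < (R i).card := by simpa using hi
    omega
  have h3 := (Finset.univ.filter fun i => b < (R i).card).biUnion R |>.card_le_univ
  rw [Fintype.card_fin] at h3
  omega

theorem le_choose_add (n : ℕ) {b : ℕ} (hb : 1 ≤ b) : n ≤ n.choose b + b := by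
  induction n with
  | zero => omega
  | succ n ih =>
    obtain ⟨c, rfl⟩ : ∃ c, b = c + 1 := ⟨b - 1, by omega⟩
    rw [Nat.choose_succ_succ]
    rcases le_or_gt c n with h | h
    · have := Nat.choose_pos h
      simp only [Nat.succ_eq_add_one]
      omega
    · omega

/-! ### The auction and its invariants -/

/-- The state of an auction of the columns, column `j` being held by row `own j - 1` (by none if
`own j = 0`): a row holds columns within one unit of its cheapest ones, and `pend i` further
columns remain to be bought by row `i`. -/
structure IsAuction (R : Fin m → Finset (Fin n)) (D pend : Fin m → ℕ) (own price : Fin n → ℕ) :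
    Prop where
  own_le : ∀ j, own j ≤ m
  price_le : ∀ j, price j ≤ n
  price_eq_zero : ∀ j, own j = 0 → price j = 0
  mem : ∀ (i : Fin m) j, own j = i + 1 → j ∈ R i
  slack : ∀ (i : Fin m) j, own j = i + 1 → ∀ j' ∈ R i, price j ≤ price j' + 1
  count : ∀ i : Fin m, (Finset.univ.filter fun j => own j = (i : ℕ) + 1).card + pend i = D i

theorem card_filter_update (own : Fin n → ℕ) (j : Fin n) (v a : ℕ) :
    (Finset.univ.filter fun j' => Function.update own j v j' = a).card +
        (if own j = a then 1 else 0) =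
      (Finset.univ.filter fun j' => own j' = a).card + if v = a then 1 else 0 := by
  simp only [Finset.card_filter]
  rw [← Finset.add_sum_erase _ _ (Finset.mem_univ j),
    ← Finset.add_sum_erase _ (fun j' => if own j' = a then 1 else 0) (Finset.mem_univ j)]
  have : ∑ x ∈ Finset.univ.erase j, (if Function.update own j v x = a then 1 else 0) =
      ∑ x ∈ Finset.univ.erase j, if own x = a then 1 else 0 :=
    Finset.sum_congr rfl fun x hx => by
      rw [Function.update_of_ne (Finset.ne_of_mem_erase hx)]
  rw [this, Function.update_self]
  omega

theorem isAuction_start (R : Fin m → Finset (Fin n)) (D : Fin m → ℕ) {own price : Fin n → ℕ}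
    (ho : ∀ j, own j = 0) (hp : ∀ j, price j = 0) : IsAuction R D D own price where
  own_le j := by simp [ho]
  price_le j := by simp [hp]
  price_eq_zero j _ := hp j
  mem i j h := by simp [ho] at h
  slack i j h := by simp [ho] at h
  count i := by simp [ho]

/-- Row `i` buys a column `j` of minimal price; its previous holder has to buy another one. -/
theorem IsAuction.take {R : Fin m → Finset (Fin n)} {D pend : Fin m → ℕ} {own price : Fin n → ℕ}
    {i : Fin m}
    (h : IsAuction R D (fun x => pend x + if (i : ℕ) + 1 = x + 1 then 1 else 0) own price)
    {j : Fin n} (hj : j ∈ R i) (hlt : price j < n) (hmin : ∀ j' ∈ R i, price j ≤ price j') :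
    IsAuction R D (fun x => pend x + if own j = x + 1 then 1 else 0)
      (Function.update own j (i + 1)) (Function.update price j (price j + 1)) where
  own_le j' := by
    rcases eq_or_ne j' j with rfl | hne
    · rw [Function.update_self]; exact i.2
    · rw [Function.update_of_ne hne]; exact h.own_le j'
  price_le j' := by
    rcases eq_or_ne j' j with rfl | hne
    · rw [Function.update_self]; exact hlt
    · rw [Function.update_of_ne hne]; exact h.price_le j'
  price_eq_zero j' := by
    rcases eq_or_ne j' j with rfl | hne
    · simp
    · simpa only [Function.update_of_ne hne] using h.price_eq_zero j'
  mem x j' := by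
    rcases eq_or_ne j' j with rfl | hne
    · rw [Function.update_self]
      intro hx
      obtain rfl : i = x := Fin.ext (by omega)
      exact hj
    · rw [Function.update_of_ne hne]; exact h.mem x j'
  slack x j' hx k hk := by
    have hmono : price k ≤ Function.update price j (price j + 1) k := by
      rcases eq_or_ne k j with rfl | hne
      · simp
      · rw [Function.update_of_ne hne]
    rcases eq_or_ne j' j with rfl | hne
    · rw [Function.update_self] at hx ⊢
      obtain rfl : i = x := Fin.ext (by omega)
      have := hmin k hk
      omega
    · rw [Function.update_of_ne hne] at hx ⊢
      have := h.slack x j' hx k hk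
      omega
  -- The purchase fills one unit of row `i` and opens one for the previous holder, if any; the count
  -- also balances if `i` already held `j`.
  count x := by
    have h1 := card_filter_update own j (i + 1) (x + 1)
    have h2 := h.count x
    omega

/-- The total price is the potential that bounds the number of sales. -/
theorem sum_update_add_one (price : Fin n → ℕ) (j : Fin n) :
    ∑ x, Function.update price j (price j + 1) x = ∑ x, price x + 1 := by
  rw [Finset.sum_update_of_mem (Finset.mem_univ j), ← Finset.add_sum_erase _ _ (Finset.mem_univ j),
    Finset.sdiff_singleton_eq_erase]
  omega

/-- A row that cannot find a column of price below `n` reveals a violation of Hall's condition. -/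
theorem IsAuction.not_hallCondition {R : Fin m → Finset (Fin n)} {D pend : Fin m → ℕ}
    {own price : Fin n → ℕ} (h : IsAuction R D pend own price) {i : Fin m} (hi : 0 < pend i)
    (hR : ∀ j ∈ R i, n ≤ price j) : ¬ HallCondition D R := by
  intro hall
  let c : ℕ → ℕ := fun k => (Finset.univ.filter fun j => k ≤ price j).card
  -- Let `S` consist of `i` and the holders of columns of price above `k`. By `slack`, all columns
  -- wanted by `S` cost at least `k`. Since `i` is still short of a column, Hall's condition for `S`
  -- forces strictly more columns of price at least `k` than of price at least `k + 1`.
  have hstep : ∀ k ≤ n, c (k + 1) + 1 ≤ c k := by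
    intro k hk
    let S : Finset (Fin m) := Finset.univ.filter fun x =>
      x = i ∨ ∃ j, own j = (x : ℕ) + 1 ∧ k + 1 ≤ price j
    have hiS : i ∈ S := by simp [S]
    have h1 : S.biUnion R ⊆ Finset.univ.filter fun j => k ≤ price j := by
      intro j hj
      obtain ⟨x, hx, hxj⟩ := Finset.mem_biUnion.1 hj
      simp only [Finset.mem_filter, Finset.mem_univ, true_and, S] at hx ⊢
      rcases hx with rfl | ⟨j', ho, hp⟩
      · exact hk.trans (hR j hxj)
      · have := h.slack x j' ho j hxj
        omega
    have h2 : (Finset.univ.filter fun j => k + 1 ≤ price j) ⊆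
        S.biUnion fun x => Finset.univ.filter fun j => own j = (x : ℕ) + 1 := by
      intro j hj
      simp only [Finset.mem_filter, Finset.mem_univ, true_and] at hj
      have ho : own j ≠ 0 := fun h0 => by have := h.price_eq_zero j h0; omega
      have hle := h.own_le j
      simp only [Finset.mem_biUnion, Finset.mem_filter, Finset.mem_univ, true_and, S]
      have hx : own j = ((⟨own j - 1, by omega⟩ : Fin m) : ℕ) + 1 := by simp only; omega
      exact ⟨⟨own j - 1, by omega⟩, Or.inr ⟨j, hx, hj⟩, hx⟩
    have h3 := (Finset.card_le_card h2).trans Finset.card_biUnion_le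
    have h4 : ∑ x ∈ S, (Finset.univ.filter fun j => own j = (x : ℕ) + 1).card + ∑ x ∈ S, pend x =
        ∑ x ∈ S, D x := by
      rw [← Finset.sum_add_distrib]
      exact Finset.sum_congr rfl fun x _ => h.count x
    have h5 : pend i ≤ ∑ x ∈ S, pend x := Finset.single_le_sum (fun _ _ => Nat.zero_le _) hiS
    have h6 := hall S
    have h7 := Finset.card_le_card h1
    simp only [c]
    omega
  have hind : ∀ k ≤ n + 1, c k + k ≤ c 0 := by
    intro k
    induction k with
    | zero => simp
    | succ k ih =>
      intro hk
      have h1 := ih (by omega)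
      have h2 := hstep k (by omega)
      omega
  -- The `n + 1` strict drops would need more than `n` columns.
  have h1 := hind (n + 1) le_rfl
  have h2 : c 0 ≤ n := (Finset.card_le_univ _).trans (by simp)
  omega

/-- With nothing pending, the columns held are disjoint sets that meet the demands. -/
theorem IsAuction.hallCondition {R : Fin m → Finset (Fin n)} {D pend : Fin m → ℕ}
    {own price : Fin n → ℕ} (h : IsAuction R D pend own price) (hp : ∀ i, pend i = 0) :
    HallCondition D R := by
  intro S
  have h1 : ∑ i ∈ S, D i =
      (S.biUnion fun x => Finset.univ.filter fun j => own j = (x : ℕ) + 1).card := by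
    rw [Finset.card_biUnion]
    · refine Finset.sum_congr rfl fun i _ => ?_
      rw [← h.count i, hp i, add_zero]
    · intro x _ y _ hxy
      refine Finset.disjoint_left.2 fun j hj hj' => hxy (Fin.ext ?_)
      simp only [Finset.mem_filter, Finset.mem_univ, true_and] at hj hj'
      omega
  rw [h1]
  refine Finset.card_le_card fun j hj => ?_
  simp only [Finset.mem_biUnion, Finset.mem_filter, Finset.mem_univ, true_and] at hj ⊢
  obtain ⟨i, hi, hij⟩ := hj
  exact ⟨i, hi, h.mem i j hij⟩

end Auction

/-! ### Total correctness with step counts -/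

namespace WordRAM

@[simp] theorem State.reg_setReg (σ : State) (r v k : ℕ) :
    (σ.setReg r v).reg k = if k = r then v else σ.reg k := by
  simp [State.setReg, Function.update_apply]

@[simp] theorem State.mem_setReg (σ : State) (r v : ℕ) : (σ.setReg r v).mem = σ.mem := rfl

@[simp] theorem State.reg_setMem (σ : State) (a v : ℕ) : (σ.setMem a v).reg = σ.reg := rfl

@[simp] theorem State.mem_setMem (σ : State) (a v k : ℕ) :
    (σ.setMem a v).mem k = if k = a then v else σ.mem k := by
  simp [State.setMem, Function.update_apply]

/-- Started in `σ`, the program `P` halts, and `Q` holds for the final state and the number of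
steps. -/
def Runs (W : ℕ) (P : Prog) (σ : State) (Q : State → ℕ → Prop) : Prop :=
  ∃ τ t, Exec W P σ τ t ∧ Q τ t

variable {W : ℕ} {p q : Prog} {σ : State} {Q : State → ℕ → Prop}

theorem Runs.mono {Q' : State → ℕ → Prop} (h : Runs W p σ Q) (hQ : ∀ τ t, Q τ t → Q' τ t) :
    Runs W p σ Q' :=
  let ⟨τ, t, hp, hq⟩ := h
  ⟨τ, t, hp, hQ τ t hq⟩

@[simp] theorem runs_instr (i : Instr) :
    Runs W (.instr i) σ Q ↔ i.value σ < W ∧ Q (i.apply σ) 1 := by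
  constructor
  · rintro ⟨τ, t, h, hQ⟩
    cases h with
    | instr _ _ h => exact ⟨h, hQ⟩
  · rintro ⟨h, hQ⟩
    exact ⟨_, _, .instr i σ h, hQ⟩

@[simp] theorem runs_seq :
    Runs W (.seq p q) σ Q ↔ Runs W p σ fun τ s => Runs W q τ fun υ t => Q υ (s + t) := by
  constructor
  · rintro ⟨υ, t, h, hQ⟩
    cases h with
    | seq hp hq => exact ⟨_, _, hp, _, _, hq, hQ⟩
  · rintro ⟨τ, s, hp, υ, t, hq, hQ⟩
    exact ⟨_, _, .seq hp hq, hQ⟩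

@[simp] theorem runs_ite {r : ℕ} :
    Runs W (.ite r p q) σ Q ↔ if σ.reg r = 0 then Runs W q σ (fun τ t => Q τ (t + 1))
      else Runs W p σ fun τ t => Q τ (t + 1) := by
  constructor
  · rintro ⟨τ, t, h, hQ⟩
    cases h with
    | ite_true h hp => rw [if_neg h]; exact ⟨_, _, hp, hQ⟩
    | ite_false h hp => rw [if_pos h]; exact ⟨_, _, hp, hQ⟩
  · split_ifs with h
    · rintro ⟨τ, t, hp, hQ⟩
      exact ⟨_, _, .ite_false h hp, hQ⟩
    · rintro ⟨τ, t, hp, hQ⟩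
      exact ⟨_, _, .ite_true h hp, hQ⟩

/-- A loop whose invariant `I τ φ` includes a bound `φ` on the remaining steps. -/
theorem Runs.while_of_budget {r : ℕ} {I : State → ℕ → Prop}
    (h : ∀ σ φ, I σ φ → σ.reg r ≠ 0 → Runs W p σ fun τ t => ∃ φ', t + 1 + φ' ≤ φ ∧ I τ φ')
    {φ : ℕ} (h₀ : I σ φ) :
    Runs W (.while r p) σ fun τ t => τ.reg r = 0 ∧ ∃ φ', t + φ' ≤ φ + 1 ∧ I τ φ' := by
  induction φ using Nat.strong_induction_on generalizing σ with
  | _ φ ih =>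
    by_cases hr : σ.reg r = 0
    · exact ⟨σ, 1, .while_false hr, hr, φ, by omega, h₀⟩
    · obtain ⟨τ, s, hp, φ', hφ, hI⟩ := h σ φ h₀ hr
      obtain ⟨υ, t, hw, hυ, φ'', hφ', hυI⟩ := ih φ' (by omega) hI
      exact ⟨υ, s + t + 1, .while_true hr hp hw, hυ, φ'', by omega, hυI⟩

/-- A loop controlled by a counter. -/
theorem Runs.while_of_counter {r : ℕ} (c N : ℕ) (I : ℕ → State → Prop)
    (h : ∀ k < N, ∀ σ, I (k + 1) σ → σ.reg r = k + 1 →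
      Runs W p σ fun τ t => t + 1 ≤ c ∧ τ.reg r = k ∧ I k τ)
    (hr : σ.reg r = N) (h₀ : I N σ) :
    Runs W (.while r p) σ fun τ t => t ≤ c * N + 1 ∧ I 0 τ := by
  induction N generalizing σ with
  | zero => exact ⟨σ, 1, .while_false hr, by simp, h₀⟩
  | succ N ih =>
    obtain ⟨τ, s, hp, hs, hτ, hI⟩ := h N (Nat.lt_succ_self N) σ h₀ hr
    obtain ⟨υ, t, hw, ht, hυ⟩ := ih (fun k hk => h k (hk.trans (Nat.lt_succ_self N))) hτ hI
    refine ⟨υ, s + t + 1, .while_true (by omega) hp hw, ?_, hυ⟩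
    rw [Nat.mul_succ]
    omega

end WordRAM

/-! ### The program

Registers: `0`, `1`, `2` hold `m`, `n`, `b`; `3` holds `1`; `4` and `5` the addresses `m * n` and
`m * n + n` of the arrays of owners and of prices of the columns; `6` the answer; `7` the row `i₀`
of the current test; `8` the row whose demand is being served, `9` the remaining demand, `10` the
row that is buying a column (plus one; zero if there is none); `11` a number of erasures; registers
from `12` on are temporary. -/

namespace TensorTest

open WordRAM

attribute [local simp] Instr.value Instr.apply

/-- Count the erasures in the row that register `s` holds. -/
def countErasures (s : ℕ) : Prog :=
  .seq (.instr (.mul 15 s 1)) <| .seq (.instr (.const 11 0)) <| .seq (.instr (.move 12 1)) <|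
  .while 12 <|
    .seq (.instr (.sub 12 12 3)) <| .seq (.instr (.add 16 15 12)) <|
    .seq (.instr (.load 17 16)) <| .instr (.add 11 11 17)

/-- Find a cheapest column for the buying row, its price being below `n`. -/
def findColumn : Prog :=
  .seq (.instr (.sub 15 10 3)) <| .seq (.instr (.mul 15 15 1)) <|
  -- The best price starts at the sentinel `n`; as only strict improvements count, it remains `n`
  -- exactly when no column costs less.
  .seq (.instr (.move 13 1)) <| .seq (.instr (.const 14 0)) <| .seq (.instr (.move 12 1)) <|
  .while 12 <|
    .seq (.instr (.sub 12 12 3)) <| .seq (.instr (.add 16 15 12)) <|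
    .seq (.instr (.load 17 16)) <|
    .ite 17
      (.seq (.instr (.add 16 5 12)) <| .seq (.instr (.load 18 16)) <|
        .seq (.instr (.sub 17 13 18)) <|
        .ite 17 (.seq (.instr (.move 13 18)) <| .instr (.move 14 12)) (.instr (.const 17 0)))
      (.instr (.const 17 0))

/-- Buy the column found; if there is none, leave all loops with the answer `0`. -/
def buyColumn : Prog :=
  .seq findColumn <| .seq (.instr (.sub 17 1 13)) <|
  .ite 17
    (.seq (.instr (.add 16 4 14)) <| .seq (.instr (.load 17 16)) <|
      .seq (.instr (.store 16 10)) <| .seq (.instr (.add 16 5 14)) <|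
      .seq (.instr (.add 13 13 3)) <| .seq (.instr (.store 16 13)) <| .instr (.move 10 17))
    (.seq (.instr (.const 6 0)) <| .seq (.instr (.const 10 0)) <|
      .seq (.instr (.const 9 0)) <| .seq (.instr (.const 8 0)) <| .instr (.const 7 0))

/-- Serve the demand of one row. -/
def serveRow : Prog :=
  .while 9 <|
    .seq (.instr (.sub 9 9 3)) <| .seq (.instr (.add 10 8 3)) <| .while 10 buyColumn

/-- Serve the demands of all rows. -/
def serveRows : Prog :=
  .while 8 <|
    .seq (.instr (.sub 8 8 3)) <| .seq (countErasures 8) <|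
    -- The sum of the two truncated differences is zero exactly for the row `i₀` under test.
    .seq (.instr (.sub 9 8 7)) <| .seq (.instr (.sub 17 7 8)) <| .seq (.instr (.add 17 17 9)) <|
    .seq (.ite 17 (.instr (.sub 9 11 2)) (.instr (.move 9 11))) serveRow

def clearArrays : Prog :=
  .seq (.instr (.const 17 0)) <| .seq (.instr (.move 12 1)) <|
  .while 12 <|
    .seq (.instr (.sub 12 12 3)) <|
    .seq (.instr (.add 16 4 12)) <| .seq (.instr (.store 16 17)) <|
    .seq (.instr (.add 16 5 12)) <| .instr (.store 16 17)

/-- Test Hall's condition for the demands that belong to the row in register `7`. -/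
def testRow : Prog :=
  .seq clearArrays <| .seq (.instr (.move 8 0)) <| .seq (.instr (.const 9 0)) <|
  .seq (.instr (.const 10 0)) serveRows

/-- Test all rows with more than `b` erasures; only the first one of them if `b = 0`. -/
def testRows : Prog :=
  .while 7 <|
    .seq (.instr (.sub 7 7 3)) <| .seq (countErasures 7) <| .seq (.instr (.sub 17 11 2)) <|
    .ite 17 (.seq testRow <| .ite 2 (.instr (.const 17 0)) (.instr (.const 7 0)))
      (.instr (.const 17 0))

def program : Prog :=
  .seq (.instr (.const 3 1)) <| .seq (.instr (.mul 4 0 1)) <| .seq (.instr (.add 5 4 1)) <|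
  .seq (.instr (.const 6 1)) <| .seq (.instr (.move 7 0)) <| .seq testRows <|
  .instr (.move 0 6)

/-! ### Correctness of the program -/

variable {m n b W : ℕ} {R : Fin m → Finset (Fin n)}

/-- The registers and the part of the memory that do not change. -/
structure Ready (b : ℕ) (R : Fin m → Finset (Fin n)) (σ : State) : Prop where
  reg_zero : σ.reg 0 = m
  reg_one : σ.reg 1 = n
  reg_two : σ.reg 2 = b
  reg_three : σ.reg 3 = 1
  reg_four : σ.reg 4 = m * n
  reg_five : σ.reg 5 = m * n + n
  mem_eq : ∀ (i : Fin m) (j : Fin n), σ.mem (i * n + j) = if j ∈ R i then 1 else 0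

theorem index_lt (i : Fin m) (j : Fin n) : (i : ℕ) * n + j < m * n := by
  have h1 : ((i : ℕ) + 1) * n ≤ m * n := Nat.mul_le_mul_right _ i.2
  have h2 := j.2
  rw [add_mul, one_mul] at h1
  omega

theorem Ready.of_eq {σ τ : State} (h : Ready b R σ) (hreg : ∀ k < 6, τ.reg k = σ.reg k)
    (hmem : ∀ a < m * n, τ.mem a = σ.mem a) : Ready b R τ where
  reg_zero := by rw [hreg 0 (by omega), h.reg_zero]
  reg_one := by rw [hreg 1 (by omega), h.reg_one]
  reg_two := by rw [hreg 2 (by omega), h.reg_two]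
  reg_three := by rw [hreg 3 (by omega), h.reg_three]
  reg_four := by rw [hreg 4 (by omega), h.reg_four]
  reg_five := by rw [hreg 5 (by omega), h.reg_five]
  mem_eq i j := by rw [hmem _ (index_lt i j), h.mem_eq]

theorem card_filter_lt_succ (T : Finset (Fin n)) (k : Fin n) :
    (T.filter fun j : Fin n => (j : ℕ) < k + 1).card =
      (T.filter fun j : Fin n => (j : ℕ) < k).card + if k ∈ T then 1 else 0 := by
  have h : (T.filter fun j : Fin n => (j : ℕ) < k + 1) =
      (T.filter fun j : Fin n => (j : ℕ) < k) ∪ T.filter fun j : Fin n => j = k := by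
    ext j
    simp only [Finset.mem_filter, Finset.mem_union, Fin.ext_iff, Nat.lt_succ_iff_lt_or_eq]
    tauto
  rw [h, Finset.card_union_of_disjoint]
  · congr 1
    rw [Finset.filter_eq']
    split_ifs <;> simp
  · refine Finset.disjoint_left.2 fun j hj hj' => ?_
    simp only [Finset.mem_filter] at hj hj'
    have := hj.2
    rw [hj'.2] at this
    omega

theorem runs_countErasures (hW : m * n + 2 * n + m + 2 ≤ W) {σ : State} (h : Ready b R σ)
    {s : ℕ} (i : Fin m) (hs : σ.reg s = i) :
    Runs W (countErasures s) σ fun τ t => t ≤ 5 * n + 4 ∧ τ.reg 11 = (R i).card ∧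
      τ.mem = σ.mem ∧ ∀ k < 11, τ.reg k = σ.reg k := by
  have hi : (i : ℕ) * n ≤ m * n := Nat.mul_le_mul_right _ i.2.le
  simp only [countErasures, runs_seq, runs_instr, Instr.value, Instr.apply]
  refine ⟨by rw [hs, h.reg_one]; omega, by omega, by simp [h.reg_one]; omega, ?_⟩
  refine (Runs.while_of_counter 5 n (fun k τ => τ.mem = σ.mem ∧ (∀ k < 11, τ.reg k = σ.reg k) ∧
    τ.reg 15 = i * n ∧ τ.reg 11 + ((R i).filter fun j : Fin n => (j : ℕ) < k).card = (R i).card)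
    ?_ ?_ ?_).mono ?_
  · rintro k hk τ ⟨hmem, hreg, h15, h11⟩ h12
    have h3 : τ.reg 3 = 1 := by rw [hreg 3 (by omega), h.reg_three]
    have hload : τ.mem (i * n + k) = if (⟨k, hk⟩ : Fin n) ∈ R i then 1 else 0 := by
      rw [hmem]; exact h.mem_eq i ⟨k, hk⟩
    have hstep := card_filter_lt_succ (R i) ⟨k, hk⟩
    have hlt := index_lt i ⟨k, hk⟩
    have hle : (R i).card ≤ n := (R i).card_le_univ.trans (by simp)
    simp only at hstep hlt
    simp [h12, h3, h15, hload, hmem]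
    split_ifs at hstep ⊢ with hmem'
    all_goals
      refine ⟨by omega, by omega, by omega, by omega, ?_, by omega⟩
      intro k hk
      rw [← hreg k hk]
      simp [show k ≠ 11 by omega, show k ≠ 12 by omega, show k ≠ 16 by omega,
        show k ≠ 17 by omega]
  · simp [h.reg_one]
  · refine ⟨rfl, fun k hk => ?_, by simp [hs, h.reg_one], ?_⟩
    · simp [show k ≠ 11 by omega, show k ≠ 12 by omega, show k ≠ 15 by omega]
    · simp
  · rintro τ t ⟨ht, hmem, hreg, -, h11⟩
    refine ⟨by omega, by simpa using h11, hmem, hreg⟩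

/-! ### Finding and buying a column -/

/-- The holders of the columns, as stored in memory. -/
def owner (m n : ℕ) (σ : State) (j : Fin n) : ℕ := σ.mem (m * n + j)

/-- The prices of the columns, as stored in memory. -/
def price (m n : ℕ) (σ : State) (j : Fin n) : ℕ := σ.mem (m * n + n + j)

theorem owner_setReg (m n : ℕ) (σ : State) (r v : ℕ) :
    owner m n (σ.setReg r v) = owner m n σ := rfl

theorem price_setReg (m n : ℕ) (σ : State) (r v : ℕ) :
    price m n (σ.setReg r v) = price m n σ := rfl

theorem runs_findColumn (hW : m * n + 2 * n + m + 2 ≤ W) {σ : State} (h : Ready b R σ)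
    (hp : ∀ j, price m n σ j ≤ n) (i : Fin m) (hi : σ.reg 10 = i + 1) :
    Runs W findColumn σ fun τ t => t ≤ 11 * n + 6 ∧ τ.mem = σ.mem ∧
      (∀ k < 12, τ.reg k = σ.reg k) ∧
      ((τ.reg 13 = n ∧ ∀ j ∈ R i, n ≤ price m n σ j) ∨
        ∃ j ∈ R i, τ.reg 14 = j ∧ τ.reg 13 = price m n σ j ∧ price m n σ j < n ∧
          ∀ j' ∈ R i, price m n σ j ≤ price m n σ j') := by
  have hin : (i : ℕ) * n ≤ m * n := Nat.mul_le_mul_right _ i.2.le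
  have him := i.2
  simp only [findColumn, runs_seq, runs_instr, Instr.value, Instr.apply]
  refine ⟨by rw [hi, h.reg_three]; omega, by simp [hi, h.reg_three, h.reg_one]; omega,
    by simp [h.reg_one]; omega, by omega, by simp [h.reg_one]; omega, ?_⟩
  refine (Runs.while_of_counter 11 n (fun k τ => τ.mem = σ.mem ∧ (∀ k < 12, τ.reg k = σ.reg k) ∧
    τ.reg 15 = i * n ∧ (∀ j ∈ R i, k ≤ (j : ℕ) → τ.reg 13 ≤ price m n σ j) ∧
      (τ.reg 13 = n ∨ ∃ j ∈ R i, τ.reg 14 = j ∧ τ.reg 13 = price m n σ j ∧ price m n σ j < n))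
    ?_ ?_ ?_).mono ?_
  · rintro k hk τ ⟨hmem, hreg, h15, hmin, hbest⟩ h12
    have h3 : τ.reg 3 = 1 := by rw [hreg 3 (by omega), h.reg_three]
    have h5 : τ.reg 5 = m * n + n := by rw [hreg 5 (by omega), h.reg_five]
    have hload : τ.mem (i * n + k) = if (⟨k, hk⟩ : Fin n) ∈ R i then 1 else 0 := by
      rw [hmem]; exact h.mem_eq i ⟨k, hk⟩
    have hlt := index_lt i ⟨k, hk⟩
    have hpk := hp ⟨k, hk⟩
    have hprice : τ.mem (m * n + n + k) = price m n σ ⟨k, hk⟩ := by rw [hmem]; rfl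
    have h13 : τ.reg 13 ≤ n := by
      rcases hbest with h | ⟨j, -, -, h, h'⟩ <;> omega
    have hsucc : ∀ j : Fin n, k ≤ (j : ℕ) → j = ⟨k, hk⟩ ∨ k + 1 ≤ (j : ℕ) := fun j hj => by
      rcases Nat.eq_or_lt_of_le hj with h | h
      · exact Or.inl (Fin.ext h.symm)
      · exact Or.inr h
    simp only at hlt
    simp [h12, h3, h5, h15, hload]
    refine ⟨by omega, by omega, ?_⟩
    by_cases hkR : (⟨k, hk⟩ : Fin n) ∈ R i
    · simp [hkR, hprice, hmem]
      refine ⟨by omega, by omega, by omega, by omega, ?_⟩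
      split_ifs with hcmp
      · refine ⟨by omega, ?_, ?_, ?_⟩
        · intro k hk
          rw [← hreg k hk]
          simp [show k ≠ 16 by omega, show k ≠ 12 by omega, show k ≠ 17 by omega,
            show k ≠ 18 by omega]
        · intro j hj hkj
          rcases hsucc j hkj with rfl | hj'
          · omega
          · exact hmin j hj hj'
        · exact hbest
      · refine ⟨by omega, by omega, ?_, ?_, ?_⟩
        · intro k hk
          rw [← hreg k hk]
          simp [show k ≠ 16 by omega, show k ≠ 12 by omega, show k ≠ 17 by omega,
            show k ≠ 18 by omega, show k ≠ 13 by omega, show k ≠ 14 by omega]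
        · intro j hj hkj
          rcases hsucc j hkj with rfl | hj'
          · omega
          · have := hmin j hj hj'
            omega
        · exact Or.inr ⟨⟨k, hk⟩, hkR, rfl, rfl, by omega⟩
    · simp [hkR, hmem]
      refine ⟨by omega, ?_, ?_, hbest⟩
      · intro k hk
        rw [← hreg k hk]
        simp [show k ≠ 16 by omega, show k ≠ 12 by omega, show k ≠ 17 by omega]
      · intro j hj hkj
        rcases hsucc j hkj with rfl | hj'
        · exact absurd hj hkR
        · exact hmin j hj hj'
  · simp [h.reg_one]
  · refine ⟨rfl, fun k hk => ?_, by simp [hi, h.reg_one, h.reg_three], ?_, ?_⟩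
    · simp [show k ≠ 12 by omega, show k ≠ 13 by omega, show k ≠ 14 by omega,
        show k ≠ 15 by omega]
    · intro j _ hj
      have := j.2
      omega
    · simp [h.reg_one]
  · rintro τ t ⟨ht, hmem, hreg, -, hmin, hbest⟩
    refine ⟨by omega, hmem, hreg, ?_⟩
    rcases hbest with h13 | ⟨j, hj, h14, h13, hlt⟩
    · exact Or.inl ⟨h13, fun j hj => h13 ▸ hmin j hj (Nat.zero_le _)⟩
    · exact Or.inr ⟨j, hj, h14, h13, hlt, fun j' hj' => h13 ▸ hmin j' hj' (Nat.zero_le _)⟩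

/-- The demands that are still to be taken up: those of the rows below `r`, and `k` units of
row `r`. -/
def remaining (D : Fin m → ℕ) (r k : ℕ) (x : Fin m) : ℕ :=
  if (x : ℕ) < r then D x else if (x : ℕ) = r then k else 0

/-- The test for the row `i₀` is under way. -/
structure Live (b : ℕ) (R : Fin m → Finset (Fin n)) (i₀ : Fin m) (r k : ℕ) (σ : State) :
    Prop where
  ready : Ready b R σ
  reg_six : σ.reg 6 = 1
  reg_seven : σ.reg 7 = i₀
  reg_eight : σ.reg 8 = r
  reg_nine : σ.reg 9 = k
  reg_ten_le : σ.reg 10 ≤ m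
  auction : IsAuction R (demand b R i₀)
    (fun x => remaining (demand b R i₀) r k x + if σ.reg 10 = x + 1 then 1 else 0)
    (owner m n σ) (price m n σ)

/-- The test for the row `i₀` has failed. -/
structure Dead (b : ℕ) (R : Fin m → Finset (Fin n)) (i₀ : Fin m) (σ : State) : Prop where
  ready : Ready b R σ
  reg_six : σ.reg 6 = 0
  reg_seven : σ.reg 7 = 0
  reg_eight : σ.reg 8 = 0
  reg_nine : σ.reg 9 = 0
  reg_ten : σ.reg 10 = 0
  not_hall : ¬ HallCondition (demand b R i₀) R

theorem runs_buyColumn (hW : m * n + 2 * n + m + 2 ≤ W) {i₀ : Fin m} {r k : ℕ} {σ : State}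
    (h : Live b R i₀ r k σ) (h10 : σ.reg 10 ≠ 0) :
    Runs W buyColumn σ fun τ t => t ≤ 11 * n + 15 ∧
      ((Live b R i₀ r k τ ∧ ∑ j, price m n τ j = ∑ j, price m n σ j + 1) ∨ Dead b R i₀ τ) := by
  obtain ⟨i, hi⟩ : ∃ i : Fin m, σ.reg 10 = i + 1 :=
    ⟨⟨σ.reg 10 - 1, by have := h.reg_ten_le; omega⟩, by simp only; omega⟩
  have him := i.2
  have hauc := h.auction
  rw [hi] at hauc
  rw [buyColumn, runs_seq]
  refine (runs_findColumn hW h.ready h.auction.price_le i hi).mono ?_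
  rintro τ s ⟨hs, hmem, hreg, hcase⟩
  have hreg1 : τ.reg 1 = n := by rw [hreg 1 (by omega), h.ready.reg_one]
  have hreg3 : τ.reg 3 = 1 := by rw [hreg 3 (by omega), h.ready.reg_three]
  have hreg4 : τ.reg 4 = m * n := by rw [hreg 4 (by omega), h.ready.reg_four]
  have hreg5 : τ.reg 5 = m * n + n := by rw [hreg 5 (by omega), h.ready.reg_five]
  have hreg10 : τ.reg 10 = i + 1 := by rw [hreg 10 (by omega), hi]
  simp [hreg1, hreg3, hreg4, hreg5, hreg10]
  rcases hcase with ⟨h13, hno⟩ | ⟨j, hj, h14, h13, hlt, hmin⟩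
  · simp [h13]
    refine ⟨by omega, by omega, Or.inr ⟨?_, by simp, by simp, by simp, by simp, by simp,
      hauc.not_hallCondition (i := i) (by simp) hno⟩⟩
    refine h.ready.of_eq (fun k hk => ?_) fun a _ => by simp [hmem]
    rw [← hreg k (by omega)]
    simp [show k ≠ 6 by omega, show k ≠ 7 by omega, show k ≠ 8 by omega, show k ≠ 9 by omega,
      show k ≠ 10 by omega, show k ≠ 17 by omega]
  · have hjn := j.2
    have hown : τ.mem (m * n + j) = owner m n σ j := by rw [hmem]; rfl
    have hole := h.auction.own_le j
    rw [if_neg (by omega)]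
    simp [h13, h14, hown]
    refine ⟨by omega, by omega, by omega, by omega, by omega, by omega, by omega, by omega,
      Or.inl ?_⟩
    generalize hυ : State.setReg _ 10 _ = υ
    have hυmem : ∀ a, υ.mem a = if a = m * n + n + j then price m n σ j + 1 else
        if a = m * n + j then (i : ℕ) + 1 else σ.mem a := fun a => by
      rw [← hυ]; simp [hmem]
    have hυreg : ∀ k < 10, υ.reg k = σ.reg k := fun k hk => by
      rw [← hυ, ← hreg k (by omega)]
      simp [show k ≠ 10 by omega, show k ≠ 13 by omega, show k ≠ 16 by omega,
        show k ≠ 17 by omega]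
    have hυ10 : υ.reg 10 = owner m n σ j := by rw [← hυ]; simp
    have hυo : owner m n υ = Function.update (owner m n σ) j (i + 1) := by
      funext x
      have := x.2
      simp only [owner, hυmem, Function.update_apply, Fin.ext_iff]
      rw [if_neg (by omega)]
      simp
    have hυp : price m n υ = Function.update (price m n σ) j (price m n σ j + 1) := by
      funext x
      have := x.2
      simp only [price, hυmem, Function.update_apply, Fin.ext_iff]
      by_cases hx : (x : ℕ) = j
      · simp [hx]
      · rw [if_neg (by omega), if_neg (by omega), if_neg hx]
    refine ⟨⟨?_, ?_, ?_, ?_, ?_, ?_, ?_⟩, ?_⟩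
    · refine h.ready.of_eq (fun k hk => hυreg k (by omega)) fun a ha => ?_
      rw [hυmem, if_neg (by omega), if_neg (by omega)]
    · rw [hυreg 6 (by omega), h.reg_six]
    · rw [hυreg 7 (by omega), h.reg_seven]
    · rw [hυreg 8 (by omega), h.reg_eight]
    · rw [hυreg 9 (by omega), h.reg_nine]
    · rw [hυ10]; exact hole
    · rw [hυ10, hυo, hυp]
      exact hauc.take hj hlt hmin
    · rw [hυp, sum_update_add_one]

/-! ### Step budget of a single test -/

/-- The test for the row `i₀` is under way, and its purchases will take at most `φ` steps; or it
has failed. -/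
def Status (b : ℕ) (R : Fin m → Finset (Fin n)) (i₀ : Fin m) (r k φ : ℕ) (σ : State) : Prop :=
  (Live b R i₀ r k σ ∧
    (11 * n + 16) * (n * n + 1) ≤ φ + (11 * n + 16) * ∑ j, price m n σ j) ∨ Dead b R i₀ σ

theorem runs_while_buyColumn (hW : m * n + 2 * n + m + 2 ≤ W) {i₀ : Fin m} {r k φ : ℕ} {σ : State}
    (h : Status b R i₀ r k φ σ) :
    Runs W (.while 10 buyColumn) σ fun τ t => τ.reg 10 = 0 ∧
      ∃ φ', t + φ' ≤ φ + 1 ∧ Status b R i₀ r k φ' τ := by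
  refine Runs.while_of_budget (I := fun τ φ => Status b R i₀ r k φ τ) (fun σ φ h h10 => ?_) h
  rcases h with ⟨h, hφ⟩ | h
  · refine (runs_buyColumn hW h h10).mono ?_
    rintro τ t ⟨ht, hτ⟩
    have hsum : ∑ j, price m n σ j ≤ n * n := by
      refine (Finset.sum_le_sum fun j _ => h.auction.price_le j).trans ?_
      simp
    have h1 := Nat.mul_le_mul_left (11 * n + 16) hsum
    rw [Nat.mul_add, Nat.mul_one] at hφ
    -- A purchase and its loop test cost at most `11 * n + 16`. As the prices sum to at most `n *
    -- n`, the `+ 1` in `n * n + 1` always leaves one round in the budget, even for a last purchase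
    -- that fails and raises no price.
    refine ⟨φ - (11 * n + 16), by omega, ?_⟩
    rcases hτ with ⟨hτ, hs⟩ | hτ
    · refine Or.inl ⟨hτ, ?_⟩
      rw [hs, Nat.mul_add, Nat.mul_add, Nat.mul_one]
      omega
    · exact Or.inr hτ
  · exact absurd h.reg_ten h10

theorem runs_serveRow (hW : m * n + 2 * n + m + 2 ≤ W) {i₀ : Fin m} {r k φ : ℕ} (hr : r < m)
    (hk : k ≤ n) {σ : State} (h : Status b R i₀ r k φ σ) (h10 : σ.reg 10 = 0) :
    Runs W serveRow σ fun τ t => τ.reg 10 = 0 ∧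
      ∃ φ', t + φ' ≤ φ + 4 * k + 1 ∧ Status b R i₀ r 0 φ' τ := by
  have hmn := Nat.zero_le (m * n)
  refine (Runs.while_of_budget (I := fun τ ψ => τ.reg 10 = 0 ∧
    ∃ k φ, k ≤ n ∧ φ + 4 * k ≤ ψ ∧ Status b R i₀ r k φ τ) ?_
    (φ := φ + 4 * k) ⟨h10, k, φ, hk, le_rfl, h⟩).mono ?_
  · rintro σ ψ ⟨h10, k, φ, hk, hφ, h | h⟩ h9
    swap
    · exact absurd h.reg_nine h9
    obtain ⟨h, hpot⟩ := h
    have hk0 : k ≠ 0 := h.reg_nine ▸ h9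
    simp [h.ready.reg_three, h.reg_nine, h.reg_eight]
    refine ⟨by omega, by omega, ?_⟩
    refine (runs_while_buyColumn hW (i₀ := i₀) (r := r) (k := k - 1) (φ := φ) (b := b) (R := R)
      (Or.inl ⟨⟨?_, ?_, ?_, ?_, ?_, ?_, ?_⟩, ?_⟩)).mono ?_
    · exact h.ready.of_eq (fun k hk => by
        simp [show k ≠ 9 by omega, show k ≠ 10 by omega]) fun a _ => by simp
    · simp [h.reg_six]
    · simp [h.reg_seven]
    · simp [h.reg_eight]
    · simp
    · simpa using hr
    -- Passing one unit from the demand of row `r` to the buyer register leaves the pending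
    -- purchases unchanged.
    · have hpend : (fun x : Fin m => remaining (demand b R i₀) r k x +
          if σ.reg 10 = x + 1 then 1 else 0) = fun x => remaining (demand b R i₀) r (k - 1) x +
          if r + 1 = (x : ℕ) + 1 then 1 else 0 := by
        funext x
        simp only [remaining, h10]
        rcases lt_trichotomy (x : ℕ) r with hx | hx | hx
        · simp [hx, hx.ne']
        · simp [hx]
          omega
        · simp [hx.ne, hx.ne', hx.not_gt]
      have := h.auction
      rw [hpend] at this
      simpa [owner_setReg, price_setReg] using this
    · exact hpot
    · rintro τ t ⟨hτ10, φ', hφ', hτ⟩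
      exact ⟨φ' + 4 * (k - 1), by omega, hτ10, k - 1, by omega, φ', le_rfl, hτ⟩
  · rintro τ t ⟨h9, ψ, hψ, h10, k, φ', -, hφ', hτ⟩
    refine ⟨h10, φ', by omega, ?_⟩
    rcases hτ with ⟨hτ, hpot⟩ | hτ
    · obtain rfl : k = 0 := by rw [← hτ.reg_nine, h9]
      exact Or.inl ⟨hτ, hpot⟩
    · exact Or.inr hτ

theorem runs_serveRows (hW : m * n + 2 * n + m + 2 ≤ W) {i₀ : Fin m} {φ : ℕ}
    {σ : State} (h : Status b R i₀ m 0 φ σ) (h10 : σ.reg 10 = 0) :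
    Runs W serveRows σ fun τ t => t ≤ φ + (9 * n + 12) * m + 1 ∧
      ((Ready b R τ ∧ τ.reg 6 = 1 ∧ τ.reg 7 = i₀ ∧ HallCondition (demand b R i₀) R) ∨
        Dead b R i₀ τ) := by
  have hmn := Nat.zero_le (m * n)
  refine (Runs.while_of_budget (I := fun τ ψ => τ.reg 10 = 0 ∧
    ∃ r φ, r ≤ m ∧ φ + (9 * n + 12) * r ≤ ψ ∧ Status b R i₀ r 0 φ τ) ?_
    (φ := φ + (9 * n + 12) * m) ⟨h10, m, φ, le_rfl, le_rfl, h⟩).mono ?_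
  · rintro σ ψ ⟨h10, r, φ, hrm, hφ, h | h⟩ h8
    swap
    · exact absurd h.reg_eight h8
    obtain ⟨h, hpot⟩ := h
    obtain ⟨r, rfl⟩ : ∃ s, r = s + 1 := ⟨r - 1, by have := h.reg_eight; omega⟩
    rw [runs_seq, runs_instr]
    refine ⟨by simp [h.reg_eight, h.ready.reg_three]; omega, ?_⟩
    rw [runs_seq]
    have hready : Ready b R ((Instr.sub 8 8 3).apply σ) :=
      h.ready.of_eq (fun k hk => by simp [show k ≠ 8 by omega]) fun a _ => by simp
    refine (runs_countErasures hW hready ⟨r, hrm⟩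
      (by simp [h.reg_eight, h.ready.reg_three])).mono ?_
    rintro τ s ⟨hs, h11, hmem, hreg⟩
    have hRn : (R ⟨r, hrm⟩).card ≤ n := (R ⟨r, hrm⟩).card_le_univ.trans (by simp)
    have hτ2 : τ.reg 2 = b := by rw [hreg 2 (by omega), hready.reg_two]
    have hτ8 : τ.reg 8 = r := by
      rw [hreg 8 (by omega)]; simp [h.reg_eight, h.ready.reg_three]
    have hτ7 : τ.reg 7 = i₀ := by rw [hreg 7 (by omega)]; simp [h.reg_seven]
    have hi₀ := i₀.2
    have hτready : Ready b R τ := hready.of_eq (fun k hk => hreg k (by omega)) fun a _ => by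
      rw [hmem]
    have hτmem : τ.mem = σ.mem := by rw [hmem]; simp
    have hD : demand b R i₀ ⟨r, hrm⟩ ≤ n := by
      unfold demand
      split_ifs <;> omega
    -- The common continuation of both branches, once register `9` holds the demand of row `r`.
    have hgoal : ∀ υ : State, υ.mem = τ.mem → (∀ k, k ≠ 9 → k ≠ 17 → υ.reg k = τ.reg k) →
        υ.reg 9 = demand b R i₀ ⟨r, hrm⟩ → Runs W serveRow υ fun ω t =>
          ∃ φ', 1 + (s + (1 + (1 + (1 + (2 + t))))) + 1 + φ' ≤ ψ ∧ ω.reg 10 = 0 ∧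
            ∃ r φ, r ≤ m ∧ φ + (9 * n + 12) * r ≤ φ' ∧ Status b R i₀ r 0 φ ω := by
      intro υ hυmem hυreg hυ9
      have hυ10 : υ.reg 10 = 0 := by
        rw [hυreg 10 (by omega) (by omega), hreg 10 (by omega)]; simp [h10]
      refine (runs_serveRow hW (i₀ := i₀) (r := r) (k := demand b R i₀ ⟨r, hrm⟩) (φ := φ) hrm hD
        (b := b) (R := R) (Or.inl ⟨⟨?_, ?_, ?_, ?_, hυ9, ?_, ?_⟩, ?_⟩) hυ10).mono ?_
      · exact hτready.of_eq (fun k hk => hυreg k (by omega) (by omega)) fun a _ => by rw [hυmem]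
      · rw [hυreg 6 (by omega) (by omega), hreg 6 (by omega)]; simp [h.reg_six]
      · rw [hυreg 7 (by omega) (by omega), hτ7]
      · rw [hυreg 8 (by omega) (by omega), hτ8]
      · omega
      · have hpend : (fun x : Fin m => remaining (demand b R i₀) (r + 1) 0 x +
            if σ.reg 10 = x + 1 then 1 else 0) = fun x =>
            remaining (demand b R i₀) r (demand b R i₀ ⟨r, hrm⟩) x +
              if υ.reg 10 = (x : ℕ) + 1 then 1 else 0 := by
          funext x
          simp only [remaining, h10, hυ10]
          rcases lt_trichotomy (x : ℕ) r with hx | hx | hx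
          · simp [hx, hx.trans (Nat.lt_succ_self r)]
          · obtain rfl : x = ⟨r, hrm⟩ := Fin.ext hx
            simp
          · simp [show ¬ (x : ℕ) < r + 1 by omega, show ¬ (x : ℕ) < r by omega,
              show (x : ℕ) ≠ r by omega]
        have := h.auction
        rw [hpend] at this
        have ho : owner m n υ = owner m n σ := by unfold owner; rw [hυmem, hτmem]
        have hp : price m n υ = price m n σ := by unfold price; rw [hυmem, hτmem]
        rw [ho, hp]
        exact this
      · have hp : price m n υ = price m n σ := by unfold price; rw [hυmem, hτmem]
        rw [hp]
        exact hpot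
      · rintro ω t ⟨hω10, φ', hφ', hω⟩
        rw [Nat.mul_add, Nat.mul_one] at hφ
        exact ⟨φ' + (9 * n + 12) * r, by omega, hω10, r, φ', by omega, le_rfl, hω⟩
    have hsub : demand b R i₀ ⟨r, hrm⟩ = if (r : ℕ) - i₀ + (i₀ - r) = 0 then (R ⟨r, hrm⟩).card
        else (R ⟨r, hrm⟩).card - b := by
      unfold demand
      congr 1
      simp only [Fin.ext_iff, eq_iff_iff]
      omega
    simp [hτ2, hτ7, hτ8, h11]
    refine ⟨by omega, by omega, by omega, ?_⟩
    split_ifs with hc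
    · refine ⟨by omega, ?_⟩
      refine (hgoal _ ?_ ?_ ?_).mono ?_
      · simp
      · intro k hk hk'
        simp [hk, hk']
      · rw [hsub, if_pos (by omega)]
        simp
      · rintro ω t ⟨φ', hφ', hω, r', φ'', hr', hφ''⟩
        exact ⟨φ', by omega, hω, r', hr', φ'', hφ''⟩
    · refine ⟨by omega, ?_⟩
      refine (hgoal _ ?_ ?_ ?_).mono ?_
      · simp
      · intro k hk hk'
        simp [hk, hk']
      · rw [hsub, if_neg (by omega)]
        simp
      · rintro ω t ⟨φ', hφ', hω, r', φ'', hr', hφ''⟩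
        exact ⟨φ', by omega, hω, r', hr', φ'', hφ''⟩
  · rintro τ t ⟨h8, ψ, hψ, h10, r, φ', -, hφ', hτ⟩
    refine ⟨by omega, ?_⟩
    rcases hτ with ⟨hτ, -⟩ | hτ
    · refine Or.inl ⟨hτ.ready, hτ.reg_six, hτ.reg_seven, hτ.auction.hallCondition fun x => ?_⟩
      obtain rfl : r = 0 := by rw [← hτ.reg_eight, h8]
      simp [remaining, h10]
    · exact Or.inr hτ

theorem runs_clearArrays (hW : m * n + 2 * n + m + 2 ≤ W) {σ : State} (h : Ready b R σ) :
    Runs W clearArrays σ fun τ t => t ≤ 6 * n + 3 ∧ (∀ k < 12, τ.reg k = σ.reg k) ∧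
      (∀ a < m * n, τ.mem a = σ.mem a) ∧ (∀ j, owner m n τ j = 0) ∧ ∀ j, price m n τ j = 0 := by
  have hmn := Nat.zero_le (m * n)
  simp only [clearArrays, runs_seq, runs_instr, Instr.value, Instr.apply]
  refine ⟨by omega, by simp [h.reg_one]; omega, ?_⟩
  refine (Runs.while_of_counter 6 n (fun k τ => (∀ k < 12, τ.reg k = σ.reg k) ∧ τ.reg 17 = 0 ∧
    (∀ a < m * n, τ.mem a = σ.mem a) ∧
      ∀ j : Fin n, k ≤ (j : ℕ) → owner m n τ j = 0 ∧ price m n τ j = 0) ?_ ?_ ?_).mono ?_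
  · rintro k hk τ ⟨hreg, h17, hmem, hclear⟩ h12
    have h3 : τ.reg 3 = 1 := by rw [hreg 3 (by omega), h.reg_three]
    have h4 : τ.reg 4 = m * n := by rw [hreg 4 (by omega), h.reg_four]
    have h5 : τ.reg 5 = m * n + n := by rw [hreg 5 (by omega), h.reg_five]
    simp [h12, h3, h4, h5, h17]
    refine ⟨by omega, by omega, by omega, by omega, by omega, ?_, ?_, ?_⟩
    · intro k hk
      rw [← hreg k hk]
      simp [show k ≠ 12 by omega, show k ≠ 16 by omega]
    · intro a ha
      rw [if_neg (by omega), if_neg (by omega), hmem a ha]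
    · intro j hj
      have hjn := j.2
      rcases Nat.eq_or_lt_of_le hj with hjk | hjk
      · simp [owner, price, hjk]
      · obtain ⟨ho, hp⟩ := hclear j hjk
        simp only [owner, price] at ho hp
        simp [owner, price, ho, hp]
  · simp [h.reg_one]
  · refine ⟨fun k hk => ?_, by simp, fun a _ => by simp, fun j hj => ?_⟩
    · simp [show k ≠ 12 by omega, show k ≠ 17 by omega]
    · have := j.2
      omega
  · rintro τ t ⟨ht, hreg, -, hmem, hclear⟩
    exact ⟨by omega, hreg, hmem, fun j => (hclear j (Nat.zero_le _)).1,
      fun j => (hclear j (Nat.zero_le _)).2⟩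

/-- A bound on the number of steps of a test. -/
def testCost (m n : ℕ) : ℕ :=
  (11 * n + 16) * (n * n + 1) + (9 * n + 12) * m + 6 * n + 7

theorem runs_testRow (hW : m * n + 2 * n + m + 2 ≤ W) {σ : State} (h : Ready b R σ) {i₀ : Fin m}
    (h6 : σ.reg 6 = 1) (h7 : σ.reg 7 = i₀) :
    Runs W testRow σ fun τ t => t ≤ testCost m n ∧
      ((Ready b R τ ∧ τ.reg 6 = 1 ∧ τ.reg 7 = i₀ ∧ HallCondition (demand b R i₀) R) ∨
        Dead b R i₀ τ) := by
  have hmn := Nat.zero_le (m * n)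
  rw [testRow, runs_seq]
  refine (runs_clearArrays hW h).mono ?_
  rintro τ s ⟨hs, hreg, hmem, ho, hp⟩
  have h0 : τ.reg 0 = m := by rw [hreg 0 (by omega), h.reg_zero]
  simp [h0]
  refine ⟨by omega, by omega, ?_⟩
  refine (runs_serveRows hW (i₀ := i₀) (φ := (11 * n + 16) * (n * n + 1)) (b := b) (R := R)
    (Or.inl ⟨⟨?_, ?_, ?_, ?_, ?_, ?_, ?_⟩, ?_⟩) ?_).mono ?_
  · refine h.of_eq (fun k hk => ?_) fun a ha => by simp [hmem a ha]
    rw [← hreg k (by omega)]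
    simp [show k ≠ 8 by omega, show k ≠ 9 by omega, show k ≠ 10 by omega]
  · simp [hreg, h6]
  · simp [hreg, h7]
  · simp
  · simp
  · simp
  · have hpend : (fun x : Fin m => remaining (demand b R i₀) m 0 x +
        if (0 : ℕ) = x + 1 then 1 else 0) = demand b R i₀ := by
      funext x
      simp [remaining]
    simp only [State.reg_setReg, if_true, owner_setReg, price_setReg, hpend]
    exact isAuction_start R _ ho hp
  · omega
  · simp
  · rintro υ t ⟨ht, hυ⟩
    refine ⟨?_, hυ⟩
    unfold testCost
    omega

/-! ### Budgeting the tests in the main loop -/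

/-- The number of rows below `v` with more than `b` erasures. -/
def heavyBelow (b : ℕ) (R : Fin m → Finset (Fin n)) (v : ℕ) : ℕ :=
  (Finset.univ.filter fun i : Fin m => (i : ℕ) < v ∧ b < (R i).card).card

theorem heavyBelow_succ {i : Fin m} (hi : b < (R i).card) :
    heavyBelow b R (i + 1) = heavyBelow b R i + 1 := by
  unfold heavyBelow
  have : (Finset.univ.filter fun x : Fin m => (x : ℕ) < i + 1 ∧ b < (R x).card) =
      insert i (Finset.univ.filter fun x : Fin m => (x : ℕ) < i ∧ b < (R x).card) := by
    ext x
    simp only [Finset.mem_filter, Finset.mem_univ, true_and, Finset.mem_insert]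
    rcases eq_or_ne x i with rfl | hx
    · simp [hi]
    · have : (x : ℕ) ≠ i := fun h => hx (Fin.ext h)
      simp only [hx, false_or, and_congr_left_iff]
      omega
  rw [this, Finset.card_insert_of_notMem (by simp)]

theorem heavyBelow_mono {v w : ℕ} (h : v ≤ w) : heavyBelow b R v ≤ heavyBelow b R w :=
  Finset.card_le_card fun i hi => by
    simp only [Finset.mem_filter, Finset.mem_univ, true_and] at hi ⊢
    exact ⟨by omega, hi.2⟩

theorem heavyBelow_le_card (v : ℕ) :
    heavyBelow b R v ≤ (Finset.univ.filter fun i => b < (R i).card).card :=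
  Finset.card_le_card fun i hi => by
    simp only [Finset.mem_filter, Finset.mem_univ, true_and] at hi ⊢
    exact hi.2

/-- If a test succeeds and `b ≠ 0`, then all the rows with more than `b` erasures can be afforded
a test. -/
theorem heavyBelow_le_min {i₀ : Fin m} (h₀ : b < (R i₀).card)
    (h : HallCondition (demand b R i₀) R) (hb : b ≠ 0) (v : ℕ) :
    heavyBelow b R v ≤ min (m.choose 1) (n.choose b) := by
  refine (heavyBelow_le_card v).trans (le_min ?_ ?_)
  · rw [Nat.choose_one_right]
    exact (Finset.card_le_univ _).trans (by simp)
  · have h1 := card_filter_add_le_of_hallCondition h₀ h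
    have h2 := le_choose_add n (b := b) (by omega)
    omega

/-- The invariant of the main loop: the rows from register `7` on have passed the test, and the
rest of the loop takes at most `φ` steps; or the answer is known. -/
def MainInvariant (b : ℕ) (R : Fin m → Finset (Fin n)) (σ : State) (φ : ℕ) : Prop :=
  Ready b R σ ∧
    ((σ.reg 6 = 1 ∧ σ.reg 7 ≤ m ∧
        (∀ i : Fin m, σ.reg 7 ≤ i → b < (R i).card → HallCondition (demand b R i) R) ∧
        -- `c` counts the tests still paid for. Before the first test nothing bounds the number of
        -- heavy rows, whence the second alternative: the full allowance is intact and only light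
        -- rows have been seen.
        ∃ c, c * testCost m n + (5 * n + 10) * σ.reg 7 ≤ φ ∧
          (heavyBelow b R (σ.reg 7) ≤ c ∨
            c = min (m.choose 1) (n.choose b) ∧
              ∀ i : Fin m, σ.reg 7 ≤ i → (R i).card ≤ b)) ∨
      (σ.reg 6 = 1 ∧ σ.reg 7 = 0 ∧ Regular b R) ∨
      (σ.reg 6 = 0 ∧ σ.reg 7 = 0 ∧ ¬ Regular b R))

theorem MainInvariant.step (hW : m * n + 2 * n + m + 2 ≤ W) (hm : 1 ≤ m) (hb : b ≤ n) {σ : State}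
    {φ : ℕ} (h : MainInvariant b R σ φ) (h7 : σ.reg 7 ≠ 0) :
    Runs W
      (.seq (.instr (.sub 7 7 3)) <| .seq (countErasures 7) <| .seq (.instr (.sub 17 11 2)) <|
        .ite 17 (.seq testRow <| .ite 2 (.instr (.const 17 0)) (.instr (.const 7 0)))
          (.instr (.const 17 0)))
      σ fun τ t => ∃ φ', t + 1 + φ' ≤ φ ∧ MainInvariant b R τ φ' := by
  have hmn := Nat.zero_le (m * n)
  obtain ⟨hready, ⟨h6, h7m, hpass, c, hc, hcount⟩ | ⟨-, h, -⟩ | ⟨-, h, -⟩⟩ := h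
  rotate_left
  · exact absurd h h7
  · exact absurd h h7
  obtain ⟨i, hi⟩ : ∃ i : Fin m, σ.reg 7 = i + 1 :=
    ⟨⟨σ.reg 7 - 1, by omega⟩, by simp only; omega⟩
  rw [hi] at hpass hc hcount
  have him := i.2
  rw [runs_seq, runs_instr]
  refine ⟨by simp [hi, hready.reg_three]; omega, ?_⟩
  rw [runs_seq]
  have hready₁ : Ready b R ((Instr.sub 7 7 3).apply σ) :=
    hready.of_eq (fun k hk => by simp [show k ≠ 7 by omega]) fun a _ => by simp
  refine (runs_countErasures hW hready₁ i (by simp [hi, hready.reg_three])).mono ?_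
  rintro τ s ⟨hs, h11, hmem, hreg⟩
  have hτ2 : τ.reg 2 = b := by rw [hreg 2 (by omega), hready₁.reg_two]
  have hτ6 : τ.reg 6 = 1 := by rw [hreg 6 (by omega)]; simp [h6]
  have hτ7 : τ.reg 7 = i := by rw [hreg 7 (by omega)]; simp [hi, hready.reg_three]
  have hτready : Ready b R τ := hready₁.of_eq (fun k hk => hreg k (by omega)) fun a _ => by
    rw [hmem]
  have hRn : (R i).card ≤ n := (R i).card_le_univ.trans (by simp)
  have hnext : ∀ x : Fin m, (i : ℕ) ≤ x → x = i ∨ (i : ℕ) + 1 ≤ x := fun x hx => by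
    rcases Nat.eq_or_lt_of_le hx with h | h
    · exact Or.inl (Fin.ext h.symm)
    · exact Or.inr h
  rw [Nat.mul_add, Nat.mul_one] at hc
  have hready_setReg : ∀ {υ : State} (k v : ℕ), 6 ≤ k → Ready b R υ →
      Ready b R (υ.setReg k v) := fun k v hk hυ =>
    hυ.of_eq (fun l hl => by simp [show l ≠ k by omega]) fun a _ => by simp
  simp only [runs_seq, runs_instr, Instr.value, Instr.apply, runs_ite, State.reg_setReg, if_true,
    h11, hτ2]
  refine ⟨by omega, ?_⟩
  have hτ17 : Ready b R (τ.setReg 17 ((R i).card - b)) := hready_setReg 17 _ (by omega) hτready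
  split_ifs with hle
  · refine ⟨by omega, c * testCost m n + (5 * n + 10) * i, by omega,
      hready_setReg 17 _ (by omega) hτ17, Or.inl ?_⟩
    simp only [State.reg_setReg, hτ6, hτ7]
    refine ⟨by simp, by simp, fun x hx hbx => ?_, c, by simp, ?_⟩
    · rcases hnext x (by simpa using hx) with rfl | hx'
      · omega
      · exact hpass x hx' hbx
    · rcases hcount with hcount | ⟨hcM, hlight⟩
      · exact Or.inl ((heavyBelow_mono (by simp)).trans hcount)
      · refine Or.inr ⟨hcM, fun x hx => ?_⟩
        rcases hnext x (by simpa using hx) with rfl | hx'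
        · omega
        · exact hlight x hx'
  · have hheavy : b < (R i).card := by omega
    -- The first test can be paid because the minimum is positive; later ones because row `i` itself
    -- is counted among the remaining heavy rows.
    have hc1 : 1 ≤ c := by
      rcases hcount with hcount | ⟨rfl, -⟩
      · rw [heavyBelow_succ hheavy] at hcount
        omega
      · rw [Nat.choose_one_right]
        exact le_min hm (Nat.choose_pos hb)
    obtain ⟨d, rfl⟩ : ∃ d, c = d + 1 := ⟨c - 1, by omega⟩
    rw [Nat.add_mul, Nat.one_mul] at hc
    refine (runs_testRow hW hτ17 (i₀ := i) (by simp [hτ6]) (by simp [hτ7])).mono ?_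
    rintro υ t ⟨ht, ⟨hυ, hυ6, hυ7, hall⟩ | hυ⟩
    · rw [hυ.reg_two]
      split_ifs with hb0
      · refine ⟨by omega, 0, by omega, hready_setReg 7 _ (by omega) hυ, Or.inr (Or.inl ?_)⟩
        refine ⟨by simp [hυ6], by simp, regular_iff_hallCondition.2 fun x _ => ?_⟩
        subst hb0
        rw [demand_zero] at hall ⊢
        exact hall
      · refine ⟨by omega, d * testCost m n + (5 * n + 10) * i, by omega,
          hready_setReg 17 _ (by omega) hυ, Or.inl ?_⟩
        simp only [State.reg_setReg, hυ6, hυ7]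
        refine ⟨by simp, by simp, fun x hx hbx => ?_, d, by simp, Or.inl ?_⟩
        · rcases hnext x (by simpa using hx) with rfl | hx'
          · exact hall
          · exact hpass x hx' hbx
        · have hsucc := heavyBelow_succ hheavy
          -- If this was the first test, its success is what bounds the remaining heavy rows by the
          -- allowance.
          have hmin := heavyBelow_le_min hheavy hall hb0 (i + 1)
          rw [if_neg (by omega)]
          rcases hcount with hcount | ⟨hcM, -⟩ <;> omega
    · have hnot : ¬ Regular b R := fun hr =>
        hυ.not_hall (regular_iff_hallCondition.1 hr i hheavy)
      rw [hυ.ready.reg_two]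
      split_ifs with hb0
      · exact ⟨by omega, 0, by omega, hready_setReg 7 _ (by omega) hυ.ready,
          Or.inr (Or.inr ⟨by simp [hυ.reg_six], by simp, hnot⟩)⟩
      · exact ⟨by omega, 0, by omega, hready_setReg 17 _ (by omega) hυ.ready,
          Or.inr (Or.inr ⟨by simp [hυ.reg_six], by simp [hυ.reg_seven], hnot⟩)⟩

theorem runs_testRows (hW : m * n + 2 * n + m + 2 ≤ W) (hm : 1 ≤ m) (hb : b ≤ n) {σ : State}
    (h : Ready b R σ) (h6 : σ.reg 6 = 1) (h7 : σ.reg 7 = m) :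
    Runs W testRows σ fun τ t =>
      t ≤ min (m.choose 1) (n.choose b) * testCost m n + (5 * n + 10) * m + 1 ∧
        ((τ.reg 6 = 1 ∧ Regular b R) ∨ (τ.reg 6 = 0 ∧ ¬ Regular b R)) := by
  refine (Runs.while_of_budget (I := MainInvariant b R)
    (φ := min (m.choose 1) (n.choose b) * testCost m n + (5 * n + 10) * m)
    (fun σ φ hI hr => hI.step hW hm hb hr) ⟨h, Or.inl ⟨h6, h7.le, fun i hi => ?_, _, ?_,
      Or.inr ⟨rfl, fun i hi => ?_⟩⟩⟩).mono ?_
  · have := i.2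
    omega
  · rw [h7]
  · have := i.2
    omega
  · rintro τ t ⟨hτ7, φ', hφ', -, ⟨hτ6, -, hpass, -⟩ | ⟨hτ6, -, hreg⟩ | ⟨hτ6, -, hreg⟩⟩
    · exact ⟨by omega, Or.inl ⟨hτ6, regular_iff_hallCondition.2 fun i hi =>
        hpass i (by omega) hi⟩⟩
    · exact ⟨by omega, Or.inl ⟨hτ6, hreg⟩⟩
    · exact ⟨by omega, Or.inr ⟨hτ6, hreg⟩⟩

/-! ### Numerical bounds and conclusion -/

theorem testCost_le (hm : 1 ≤ m) (n : ℕ) : testCost m n ≤ 35 * (m + n) ^ 3 := by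
  obtain ⟨k, rfl⟩ : ∃ k, m = k + 1 := ⟨m - 1, by omega⟩
  unfold testCost
  ring_nf
  nlinarith [Nat.zero_le (k * n), Nat.zero_le (k * n ^ 2), Nat.zero_le (k ^ 2 * n),
    Nat.zero_le (k ^ 3), Nat.zero_le (k ^ 2), Nat.zero_le (n ^ 3), Nat.zero_le (n ^ 2)]

theorem runs_program (hm : 1 ≤ m) (hb : b ≤ n) (E : Finset (Fin m × Fin n)) :
    Runs ((m + n + 2) ^ 3) program (inputState m n b E) fun τ t =>
      t ≤ 52 * (min (m.choose 1) (n.choose b) * (m + n) ^ 3) ∧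
        ((τ.reg 0 = 1 ∧ Regular b (rowSupport E)) ∨
          (τ.reg 0 = 0 ∧ ¬ Regular b (rowSupport E))) := by
  -- The left side exceeds every address of the matrix and the two arrays, and every value stored.
  have hW : m * n + 2 * n + m + 2 ≤ (m + n + 2) ^ 3 := by
    ring_nf
    nlinarith [Nat.zero_le (m * n), Nat.zero_le (m * n ^ 2), Nat.zero_le (m ^ 2 * n),
      Nat.zero_le (m ^ 3), Nat.zero_le (m ^ 2), Nat.zero_le (n ^ 3), Nat.zero_le (n ^ 2)]
  have hmn := Nat.zero_le (m * n)
  have h0 : (inputState m n b E).reg 0 = m := rfl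
  have h1 : (inputState m n b E).reg 1 = n := rfl
  have h2 : (inputState m n b E).reg 2 = b := rfl
  have hmem : ∀ (i : Fin m) (j : Fin n), (inputState m n b E).mem (i * n + j) =
      if j ∈ rowSupport E i then 1 else 0 := by
    intro i j
    simp only [inputState, mem_rowSupport]
    congr 1
    rw [eq_iff_iff]
    constructor
    · rintro ⟨i', j', hE, heq⟩
      have hn : 0 < n := j.pos
      have hi : (i : ℕ) = i' := by
        have h := congrArg (· / n) heq
        simpa [Nat.add_div_of_dvd_right, Nat.mul_add_div, Nat.mul_comm _ n, Nat.div_eq_of_lt,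
          hn, j.2, j'.2] using h
      have hi' : i = i' := Fin.ext hi
      subst hi'
      have hj : j = j' := Fin.ext (by omega)
      rwa [hj]
    · exact fun h => ⟨i, j, h, rfl⟩
  generalize inputState m n b E = σ at h0 h1 h2 hmem
  simp [program, h0, h1]
  refine ⟨by omega, by omega, by omega, ?_⟩
  refine (runs_testRows hW hm hb (R := rowSupport E) ⟨?_, ?_, ?_, ?_, ?_, ?_, ?_⟩ ?_ ?_).mono ?_
  any_goals simp [h0, h1, h2]
  · exact hmem
  · intro τ t ht hτ
    have hM : 1 ≤ min m (n.choose b) := le_min hm (Nat.choose_pos hb)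
    have hT := Nat.mul_le_mul_left (min m (n.choose b)) (testCost_le hm n)
    -- The scan of the rows and the seven steps around the main loop are charged once, which gives
    -- `52 = 35 + 17`.
    have h17 : (5 * n + 10) * m + 7 ≤ 17 * (m + n) ^ 3 := by
      obtain ⟨k, rfl⟩ : ∃ k, m = k + 1 := ⟨m - 1, by omega⟩
      ring_nf
      nlinarith [Nat.zero_le (k * n), Nat.zero_le (k * n ^ 2), Nat.zero_le (k ^ 2 * n),
        Nat.zero_le (k ^ 3), Nat.zero_le (k ^ 2), Nat.zero_le (n ^ 3), Nat.zero_le (n ^ 2)]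
    have hMN : (m + n) ^ 3 ≤ min m (n.choose b) * (m + n) ^ 3 := Nat.le_mul_of_pos_left _ hM
    have h35 : min m (n.choose b) * (35 * (m + n) ^ 3) =
        35 * (min m (n.choose b) * (m + n) ^ 3) := by ring
    refine ⟨?_, ?_, hτ⟩
    · rcases hτ with ⟨h, -⟩ | ⟨h, -⟩ <;> omega
    · omega

end TensorTest

theorem theorem1p6 :
    ∃ (P : WordRAM.Prog) (K c : ℕ), ∀ (m n b : ℕ), 1 ≤ m → b ≤ n →
      ∀ E : Finset (Fin m × Fin n), ∃ (τ : WordRAM.State) (t : ℕ),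
        WordRAM.Exec ((m + n + 2) ^ c) P (inputState m n b E) τ t ∧
        t ≤ K * (min (m.choose 1) (n.choose b) * (m + n) ^ 3) ∧
        (τ.reg 0 = 0 ∨ τ.reg 0 = 1) ∧
        (τ.reg 0 = 1 ↔ TopologyCorrectable 1 b E) ∧
        ∀ (F : Type*) [Field F] (C : Submodule F (Matrix (Fin m) (Fin n) F)),
          IsMRTensorCode 1 b C → (τ.reg 0 = 1 ↔ Correctable C E) := by
  refine ⟨TensorTest.program, 52, 3, fun m n b hm hb E => ?_⟩
  obtain ⟨τ, t, hexec, ht, hτ⟩ := TensorTest.runs_program hm hb E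
  have hiff : τ.reg 0 = 1 ↔ Regular b (rowSupport E) := by
    rcases hτ with ⟨h, hr⟩ | ⟨h, hr⟩ <;> simp [h, hr]
  refine ⟨τ, t, hexec, ht, ?_, ?_, fun F _ C hC => ?_⟩
  · rcases hτ with ⟨h, -⟩ | ⟨h, -⟩ <;> simp [h]
  · rw [hiff, topologyCorrectable_iff_regular hm hb]
  · rw [hiff, hC.correctable_iff_regular hm hb]
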